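/- Let $H$ be a complex Hilbert space. A JW-algebra on $H$ is a real linear space $A\subset B(H)$ of self-adjoint operators that is closed under the Jordan product $a\circ b=\frac12(ab+ba)$ and in the weak operator topology; it is reversible if $a_1a_2\cdots a_n+a_n\cdots a_2a_1\in A$ for all $n\ge 1$ and $a_1,\dots,a_n\in A$. Let $R(A)$ and $W(A)$ denote the weakly closed real $*$-algebra and the weakly closed complex $*$-algebra in $B(H)$ generated by $A$. Let $A$ be a reversible JW-algebra with a faithful normal state $\rho$, and let $\rho_1$ be the extension of $\rho$ to $W(A)$ determined by $\rho_1(x)=\rho(a)$ for $x\in W(A)^+$, where $x=a+ib$ with $a\in A$, $b\in R(A)$, $b^*=-b$ and $b\,y=0$ for all $y\in R(A)\cap iR(A)$ (the last condition is void if $R(A)\cap iR(A)=\{0\}$; in general it makes $a$ unique), extended to $W(A)$ by complex linearity. Let $M$ be $A$ or $W(A)$, with state $\varphi=\rho$ or $\varphi=\rho_1$ respectively. For $D_m\in M^+$ $(m\ge 1)$ with $\sum_m\varphi(D_m)<\infty$, the bundle $P^M_{(D_m)}$ is the set of all projections $p\in M$, $p\ne 0$, such that $\sup_m\bigl\|p\bigl(\sum_{k=1}^m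 D_k\bigr)p\bigr\|<\infty$ and $\|pD_mp\|\to 0$. A sequence $(x_n)$ in $W(A)$ is bundle convergent to $x\in W(A)$ in $(W(A),\rho_1)$ if there is such a sequence $(D_m)$ in $W(A)^+$ with $\|(x_n-x)p\|\to 0$ for every $p\in P^{W(A)}_{(D_m)}$. A sequence $(x_n)$ in $A$ is bundle convergent to $x\in A$ in $(A,\rho)$ if there is such a sequence $(D_m)$ in $A^+$ with $\|p(x_n-x)^2p\|\to 0$ for every $p\in P^A_{(D_m)}$. Then every sequence $(x_n)\subset A$ that is bundle convergent in $(W(A),\rho_1)$ is bundle convergent in $(A,\rho)$. More precisely, if $(x_n)\subset A$ is bundle convergent to $x\in W(A)$ in $(W(A),\rho_1)$, then $x\in A$ and $(x_n)$ is bundle convergent to $x$ in $(A,\rho)$. -/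

import Mathlib

open Filter Topology
open scoped ComplexStarModule

noncomputable section

namespace JWBundle

variable {H : Type*} [NormedAddCommGroup H] [InnerProductSpace ℂ H] [CompleteSpace H]

/-- A set of bounded operators is closed in the weak operator topology. -/
def IsWOTClosed (S : Set (H →L[ℂ] H)) : Prop :=
  IsClosed {T : H →WOT[ℂ] H | T.toCLM ∈ S}

/-- A JW-algebra: a real linear space of bounded self-adjoint operators on a complex Hilbert space,
closed under the Jordan product and in the weak operator topology.
It is not required to contain the identity operator of `H`. -/
structure IsJWAlgebra (A : Submodule ℝ (H →L[ℂ] H)) : Prop where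
  selfAdjoint : ∀ a ∈ A, IsSelfAdjoint a
  jordan_mem : ∀ a ∈ A, ∀ b ∈ A, (1 / 2 : ℝ) • (a * b + b * a) ∈ A
  closed : IsWOTClosed (A : Set (H →L[ℂ] H))

/-- `A` is reversible: `a₁ a₂ ⋯ aₙ + aₙ ⋯ a₂ a₁ ∈ A` for all `n ≥ 1` and `a₁, …, aₙ ∈ A`. -/
def IsReversible (A : Submodule ℝ (H →L[ℂ] H)) : Prop :=
  ∀ l : List (H →L[ℂ] H), l ≠ [] → (∀ a ∈ l, a ∈ A) → l.prod + l.reverse.prod ∈ A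

/-- `R(A)`: the weakly closed real `*`-algebra in `B(H)` generated by `A`. -/
def realEnvelope (A : Submodule ℝ (H →L[ℂ] H)) : NonUnitalStarSubalgebra ℝ (H →L[ℂ] H) :=
  sInf {B | (A : Set (H →L[ℂ] H)) ⊆ B ∧ IsWOTClosed (B : Set (H →L[ℂ] H))}

/-- `W(A)`: the (complex) `W*`-algebra in `B(H)` generated by `A`, i.e. the smallest weakly closed
complex `*`-subalgebra of `B(H)` that contains `A`. Its unit is the unit of `A`. -/
def envelope (A : Submodule ℝ (H →L[ℂ] H)) : NonUnitalStarSubalgebra ℂ (H →L[ℂ] H) :=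
  sInf {B | (A : Set (H →L[ℂ] H)) ⊆ B ∧ IsWOTClosed (B : Set (H →L[ℂ] H))}

theorem subset_realEnvelope (A : Submodule ℝ (H →L[ℂ] H)) {a : H →L[ℂ] H} (ha : a ∈ A) :
    a ∈ realEnvelope A :=
  NonUnitalStarAlgebra.mem_sInf.2 fun _ hB => hB.1 ha

theorem subset_envelope (A : Submodule ℝ (H →L[ℂ] H)) {a : H →L[ℂ] H} (ha : a ∈ A) :
    a ∈ envelope A :=
  NonUnitalStarAlgebra.mem_sInf.2 fun _ hB => hB.1 ha

/-- A faithful normal state on a JW-algebra `A`. The order is the usual (Loewner) order of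
operators, normality is the preservation of suprema of upward directed sets, and the
normalization refers to the unit of `A`. -/
structure IsFaithfulNormalState (A : Submodule ℝ (H →L[ℂ] H)) (ρ : A →ₗ[ℝ] ℝ) : Prop where
  nonneg : ∀ a : A, 0 ≤ (a : H →L[ℂ] H) → 0 ≤ ρ a
  unit : ∃ e : A, (∀ a ∈ A, (e : H →L[ℂ] H) * a = a ∧ a * (e : H →L[ℂ] H) = a) ∧ ρ e = 1
  faithful : ∀ a : A, 0 ≤ (a : H →L[ℂ] H) → ρ a = 0 → a = 0
  normal : ∀ (S : Set A) (s : A), S.Nonempty → DirectedOn (· ≤ ·) S → IsLUB S s →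
    IsLUB (ρ '' S) (ρ s)

/-- The decomposition `x = a + i b` with `a ∈ A` and `b ∈ R(A)` skew-adjoint. If
`R(A) ∩ i R(A) = {0}` the condition `annihilates` is void. In general `R(A) ∩ i R(A)` is a weakly
closed ideal on which `R(A)` is already a complex algebra, and `annihilates` says that `b` has no
component in that ideal; without this, `a` would not be determined by `x`. -/
structure IsDecomposition (A : Submodule ℝ (H →L[ℂ] H)) (x a b : H →L[ℂ] H) : Prop where
  left_mem : a ∈ A
  right_mem : b ∈ realEnvelope A
  skew : star b = -b
  annihilates : ∀ y ∈ realEnvelope A, Complex.I • y ∈ realEnvelope A → b * y = 0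
  eq : x = a + Complex.I • b

theorem IsDecomposition.unique {A : Submodule ℝ (H →L[ℂ] H)} {x a b a' b' : H →L[ℂ] H}
    (h : IsDecomposition A x a b) (h' : IsDecomposition A x a' b') : a = a' := by
  have hI : Complex.I • (b - b') = a' - a := by
    have := h.eq.symm.trans h'.eq
    rw [smul_sub, sub_eq_sub_iff_add_eq_add, add_comm, this, add_comm]
  have hd : b - b' ∈ realEnvelope A := sub_mem h.right_mem h'.right_mem
  have hd' : Complex.I • (b - b') ∈ realEnvelope A :=
    hI ▸ sub_mem (subset_realEnvelope A h'.left_mem) (subset_realEnvelope A h.left_mem)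
  have h0 : (b - b') * (b - b') = 0 := by
    rw [sub_mul b b', h.annihilates _ hd hd', h'.annihilates _ hd hd', sub_zero]
  have hs : star (b - b') = -(b - b') := by
    rw [star_sub, h.skew, h'.skew]; abel
  have : star (b - b') * (b - b') = 0 := by rw [hs, neg_mul, h0, neg_zero]
  have hz : b - b' = 0 := (CStarRing.star_mul_self_eq_zero_iff _).1 this
  rw [hz, smul_zero] at hI
  exact (sub_eq_zero.1 hI.symm).symm

open Classical in
/-- `x = a + i b ↦ ρ(a)` for self-adjoint `x ∈ W(A)`, with `a`, `b` as in `IsDecomposition`. -/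
def saExtension (A : Submodule ℝ (H →L[ℂ] H)) (ρ : A →ₗ[ℝ] ℝ) (x : H →L[ℂ] H) : ℝ :=
  if h : ∃ a : A, ∃ b, IsDecomposition A x a b then ρ h.choose else 0

theorem saExtension_eq {A : Submodule ℝ (H →L[ℂ] H)} (ρ : A →ₗ[ℝ] ℝ) {x b : H →L[ℂ] H} {a : A}
    (h : IsDecomposition A x a b) : saExtension A ρ x = ρ a := by
  have hex : ∃ a : A, ∃ b, IsDecomposition A x a b := ⟨a, b, h⟩
  rw [saExtension, dif_pos hex]
  obtain ⟨b', hb'⟩ := hex.choose_spec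
  exact congrArg ρ (Subtype.ext (hb'.unique h))

/-- The canonical extension `ρ₁` of `ρ` to `W(A)`: it maps `x = a + i b ∈ W(A)⁺`, decomposed as
in `IsDecomposition`, to `ρ(a)`; in general `x = ℜ x + i ℑ x` goes to `ρ₁(ℜ x) + i ρ₁(ℑ x)`. -/
def stateExtension (A : Submodule ℝ (H →L[ℂ] H)) (ρ : A →ₗ[ℝ] ℝ) (x : envelope A) : ℂ :=
  (saExtension A ρ (ℜ (x : H →L[ℂ] H) : H →L[ℂ] H) : ℂ) +
    Complex.I * (saExtension A ρ (ℑ (x : H →L[ℂ] H) : H →L[ℂ] H) : ℂ)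

theorem stateExtension_eq {A : Submodule ℝ (H →L[ℂ] H)} (ρ : A →ₗ[ℝ] ℝ) {x : envelope A}
    (hx : 0 ≤ (x : H →L[ℂ] H)) {a : A} {b : H →L[ℂ] H}
    (h : IsDecomposition A (x : H →L[ℂ] H) a b) : stateExtension A ρ x = (ρ a : ℂ) := by
  have hsa : IsSelfAdjoint (x : H →L[ℂ] H) := .of_nonneg hx
  have h0 : IsDecomposition A (0 : H →L[ℂ] H) (0 : A) 0 :=
    ⟨zero_mem _, zero_mem _, by simp, by simp, by simp⟩
  rw [stateExtension, hsa.coe_realPart, hsa.imaginaryPart, saExtension_eq ρ h]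
  simp [saExtension_eq ρ h0]

/-- The bundle determined by the sequence `D`, with projections taken from `S`. -/
def bundle (S : Set (H →L[ℂ] H)) (D : ℕ → H →L[ℂ] H) : Set (H →L[ℂ] H) :=
  {p | p ∈ S ∧ IsStarProjection p ∧ p ≠ 0 ∧
    BddAbove (Set.range fun m => ‖p * (∑ k ∈ Finset.range (m + 1), D k) * p‖) ∧
    Tendsto (fun m => ‖p * D m * p‖) atTop (𝓝 0)}

/-- `x n` is bundle convergent to `y` in `(W, φ)`, for a von Neumann algebra `W` on `H` with
state `φ`. -/
def BundleTendstoW (W : NonUnitalStarSubalgebra ℂ (H →L[ℂ] H)) (φ : W → ℂ)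
    (x : ℕ → H →L[ℂ] H) (y : H →L[ℂ] H) : Prop :=
  (∀ n, x n ∈ W) ∧ y ∈ W ∧
    ∃ D : ℕ → W, (∀ m, 0 ≤ (D m : H →L[ℂ] H)) ∧ (Summable fun m => φ (D m)) ∧
      ∀ p ∈ bundle (W : Set (H →L[ℂ] H)) (fun m => (D m : H →L[ℂ] H)),
        Tendsto (fun n => ‖(x n - y) * p‖) atTop (𝓝 0)

/-- `x n` is bundle convergent to `y` in `(A, ρ)`, for a JW-algebra `A` with state `ρ`. -/
def BundleTendstoJW (A : Submodule ℝ (H →L[ℂ] H)) (ρ : A →ₗ[ℝ] ℝ)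
    (x : ℕ → H →L[ℂ] H) (y : H →L[ℂ] H) : Prop :=
  (∀ n, x n ∈ A) ∧ y ∈ A ∧
    ∃ D : ℕ → A, (∀ m, 0 ≤ (D m : H →L[ℂ] H)) ∧ (Summable fun m => ρ (D m)) ∧
      ∀ p ∈ bundle (A : Set (H →L[ℂ] H)) (fun m => (D m : H →L[ℂ] H)),
        Tendsto (fun n => ‖p * (x n - y) ^ 2 * p‖) atTop (𝓝 0)

end JWBundle

end

/-! The core is a domination: every positive `x` in `W(A)` decomposes as `x = a + i b` with `a` in
`A` and `x ≤ 2a`. Given control operators `D m` in `W(A)⁺`, their parts `a m` are positive with `ρ(a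
m) = ρ₁(D m)`, so they are summable, and `D m ≤ 2 a m` puts the bundle of `(a m)` in `A` inside the
bundle of `(D m)` in `W(A)`. On it the C*-identity gives `‖p (x n - y)² p‖ = ‖(x n - y) p‖² → 0`.

The domination (`exists_isDecomposition`) comes from a conjugation. View `H` as a real Hilbert
space. The real operators commuting with `A` split into complex linear ones and conjugate linear
ones. A positive `x` in the complex bicommutant commutes with the former. Its conjugate `z` is
defined by `z k = k x` for every conjugate linear `k` in the commutant, and by `z = x` on the
orthogonal complement of their ranges. Conjugating the square root of `x` shows `z ≥ 0`. The
conjugate linear `k` interchange `x` and `z`, so `a = (x + z) / 2` and `b = -i (x - z) / 2` commute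
with the whole real commutant. A real double commutant argument puts `b` in `R(A)` and, by
reversibility, `a` in `A`; finally `2a = x + z ≥ x`.

It remains to show `y ∈ A`. If the bundle of `(a m)` contains projections `p j` tending strongly to
the unit, then each `p j y p j` is a norm limit of elements `p j x n p j` of `A`, and these
compressions tend strongly to `y`. Such projections exist by `exists_projections_of_bounded`: for
increasing `S n` in `A⁺` with `ρ(S n)` bounded, the resolvents `e - S n (1 + S n)⁻¹` decrease to
some `T`. Normality and faithfulness of `ρ` force `T` to have dense range in `e H`, and the range
projections of `(T - δ)₊` compress all `S n` uniformly. Applying this to sums weighted by a sequence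
tending to infinity yields both bundle conditions. -/

set_option linter.unusedSectionVars false

noncomputable section

namespace JWBundle

variable {H : Type*} [NormedAddCommGroup H] [InnerProductSpace ℂ H] [CompleteSpace H]

/-! ### Density for real operator algebras without unit -/

section Bicommutant

variable {V : Type*} [NormedAddCommGroup V] [InnerProductSpace ℝ V] [CompleteSpace V]

/-- The diagonal amplification of an operator. -/
def amplify (n : ℕ) (t : V →L[ℝ] V) :
    PiLp 2 (fun _ : Fin n => V) →L[ℝ] PiLp 2 (fun _ : Fin n => V) :=
  (PiLp.continuousLinearEquiv 2 ℝ (fun _ : Fin n => V)).symm.toContinuousLinearMap ∘L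
    ContinuousLinearMap.pi (fun i => t ∘L PiLp.proj 2 (fun _ : Fin n => V) i)

@[simp]
theorem amplify_apply (n : ℕ) (t : V →L[ℝ] V) (g : PiLp 2 (fun _ : Fin n => V)) (i : Fin n) :
    amplify n t g i = t (g i) := rfl

theorem inner_amplify (n : ℕ) (t : V →L[ℝ] V) (g h : PiLp 2 (fun _ : Fin n => V)) :
    inner ℝ (amplify n t g) h = inner ℝ g (amplify n (star t) h) := by
  simp [PiLp.inner_apply, ContinuousLinearMap.star_eq_adjoint,
    ContinuousLinearMap.adjoint_inner_right]

theorem commute_starProjection_of_invariant {G : Type*} [NormedAddCommGroup G]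
    [InnerProductSpace ℝ G] [CompleteSpace G] (M : Submodule ℝ G) [M.HasOrthogonalProjection]
    (t s : G →L[ℝ] G) (hts : ∀ g h, inner ℝ (t g) h = inner ℝ g (s h))
    (ht : ∀ m ∈ M, t m ∈ M) (hs : ∀ m ∈ M, s m ∈ M) (g : G) :
    M.starProjection (t g) = t (M.starProjection g) := by
  refine (Submodule.eq_starProjection_of_mem_of_inner_eq_zero
    (ht _ (Submodule.starProjection_apply_mem _ _)) fun m hm => ?_)
  rw [← map_sub, hts]
  exact Submodule.starProjection_inner_eq_zero _ _ (hs m hm)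

/-- Density half of the double commutant theorem for real operator algebras. -/
theorem exists_approx_of_mem_bicommutant (R : Submodule ℝ (V →L[ℝ] V))
    (hmul : ∀ r ∈ R, ∀ s ∈ R, r * s ∈ R) (hstar : ∀ r ∈ R, star r ∈ R) {e : V →L[ℝ] V}
    (he : e ∈ R) (x : V →L[ℝ] V)
    (hx : ∀ k : V →L[ℝ] V, (∀ r ∈ R, r * k = k * r) → x * k = k * x)
    {n : ℕ} (ξ : Fin n → V) {ε : ℝ} (hε : 0 < ε) :
    ∃ r ∈ R, ∀ i, ‖r (ξ i) - x (e (ξ i))‖ < ε := by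
  let Φ : R →ₗ[ℝ] PiLp 2 (fun _ : Fin n => V) :=
    { toFun := fun r => WithLp.toLp 2 fun i => (r : V →L[ℝ] V) (ξ i)
      map_add' := fun r s => by ext i; simp
      map_smul' := fun c r => by ext i; simp }
  -- The closed orbit of the tuple `ξ` under the amplified algebra; it suffices that the
  -- amplification of `x` maps it into itself.
  let M := (LinearMap.range Φ).topologicalClosure
  have hinv : ∀ r ∈ R, ∀ m ∈ M, amplify n r m ∈ M := by
    intro r hr m hm
    have h1 : Set.MapsTo (amplify n r) (LinearMap.range Φ : Set (PiLp 2 (fun _ : Fin n => V)))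
        (LinearMap.range Φ) := by
      rintro _ ⟨s, rfl⟩
      exact ⟨⟨r * s, hmul r hr s s.2⟩, by ext i; rfl⟩
    exact h1.closure (amplify n r).continuous hm
  have hMc : IsClosed (M : Set (PiLp 2 (fun _ : Fin n => V))) :=
    Submodule.isClosed_topologicalClosure _
  have : CompleteSpace M := hMc.completeSpace_coe
  have hcomm : ∀ r ∈ R, ∀ g, M.starProjection (amplify n r g) = amplify n r (M.starProjection g) :=
    fun r hr g => commute_starProjection_of_invariant M _ _ (inner_amplify n r) (hinv r hr)
      (hinv _ (hstar r hr)) g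
  let S : Fin n → V →L[ℝ] PiLp 2 (fun _ : Fin n => V) := fun j =>
    (PiLp.continuousLinearEquiv 2 ℝ (fun _ : Fin n => V)).symm.toContinuousLinearMap ∘L
      ContinuousLinearMap.single ℝ (fun _ : Fin n => V) j
  have hS : ∀ (t : V →L[ℝ] V) j v, amplify n t (S j v) = S j (t v) := by
    intro t j v
    ext i
    by_cases h : i = j
    · subst h; simp [S]
    · simp [S, h]
  have hdec : ∀ g : PiLp 2 (fun _ : Fin n => V), g = ∑ j, S j (g j) := by
    intro g
    ext i
    simp [S, Finset.sum_apply, Pi.single_apply]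
  -- The matrix entries of the projection onto `M` commute with `R`, hence with `x`; therefore the
  -- amplified `x` commutes with this projection.
  let P : Fin n → Fin n → V →L[ℝ] V := fun i j =>
    PiLp.proj 2 (fun _ : Fin n => V) i ∘L M.starProjection ∘L S j
  have hP : ∀ i j, ∀ r ∈ R, r * P i j = P i j * r := by
    intro i j r hr
    ext v
    have := congrArg (fun g => g i) (hcomm r hr (S j v))
    simp only [hS, amplify_apply] at this
    exact this.symm
  have hxcomm : ∀ g, M.starProjection (amplify n x g) = amplify n x (M.starProjection g) := by
    intro g
    rw [hdec g]
    simp only [map_sum, hS]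
    refine Finset.sum_congr rfl fun j _ => ?_
    ext i
    exact (congrArg (fun t => t (g j)) (hx _ (hP i j))).symm
  -- Since `R` need not contain the identity, `ξ` itself may lie outside `M`; the tuple `e ξ` does
  -- lie in `M`, whence the factor `e` in the conclusion.
  have hmem : amplify n x (Φ ⟨e, he⟩) ∈ M := by
    have h1 : Φ ⟨e, he⟩ ∈ M := Submodule.le_topologicalClosure _ ⟨_, rfl⟩
    rw [← Submodule.starProjection_eq_self_iff.2 h1, ← hxcomm]
    exact Submodule.starProjection_apply_mem _ _
  obtain ⟨_, ⟨r, rfl⟩, hr⟩ := Metric.mem_closure_iff.1 hmem ε hε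
  refine ⟨r, r.2, fun i => lt_of_le_of_lt ?_ hr⟩
  rw [dist_comm, dist_eq_norm]
  exact PiLp.norm_apply_le (Φ r - amplify n x (Φ ⟨e, he⟩)) i

end Bicommutant

/-! ### The conjugate of an operator through the anticommutant -/

section Conjugation

variable {V : Type*} [NormedAddCommGroup V] [InnerProductSpace ℝ V] [CompleteSpace V]

/-- The operators commuting with `S` and `J`. -/
def linCommutant (S : Set (V →L[ℝ] V)) (J : V →L[ℝ] V) : Set (V →L[ℝ] V) :=
  {k | (∀ a ∈ S, a * k = k * a) ∧ J * k = k * J}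

/-- The operators commuting with `S` and anticommuting with `J`. -/
def antiCommutant (S : Set (V →L[ℝ] V)) (J : V →L[ℝ] V) : Set (V →L[ℝ] V) :=
  {k | (∀ a ∈ S, a * k = k * a) ∧ J * k = -(k * J)}

/-- The linear map `(ξ_k) ↦ ∑ k ξ_k` on finitely supported families indexed by the
anticommutant. -/
def antiSum (S : Set (V →L[ℝ] V)) (J : V →L[ℝ] V) : (antiCommutant S J →₀ V) →ₗ[ℝ] V :=
  Finsupp.lsum ℝ fun k => (k : V →L[ℝ] V).toLinearMap

/-- The closed subspace spanned by the ranges of the operators in the anticommutant. -/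
def antiSpace (S : Set (V →L[ℝ] V)) (J : V →L[ℝ] V) : Submodule ℝ V :=
  (LinearMap.range (antiSum S J)).topologicalClosure

instance (S : Set (V →L[ℝ] V)) (J : V →L[ℝ] V) : CompleteSpace (antiSpace S J) :=
  (Submodule.isClosed_topologicalClosure _).completeSpace_coe

/-- The projection onto the orthogonal complement of `antiSpace`. -/
def antiCompl (S : Set (V →L[ℝ] V)) (J : V →L[ℝ] V) : V →L[ℝ] V :=
  1 - (antiSpace S J).starProjection

variable {S : Set (V →L[ℝ] V)} {J : V →L[ℝ] V}

@[simp]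
theorem antiSum_single (k : antiCommutant S J) (ξ : V) :
    antiSum S J (Finsupp.single k ξ) = (k : V →L[ℝ] V) ξ := by
  simp [antiSum]

theorem apply_mem_antiSpace {k : V →L[ℝ] V} (hk : k ∈ antiCommutant S J) (ξ : V) :
    k ξ ∈ antiSpace S J :=
  Submodule.le_topologicalClosure _ ⟨Finsupp.single ⟨k, hk⟩ ξ, antiSum_single _ _⟩

theorem starProjection_mul_of_mem_anti {k : V →L[ℝ] V} (hk : k ∈ antiCommutant S J) :
    (antiSpace S J).starProjection * k = k := by
  ext ξ
  exact Submodule.starProjection_eq_self_iff.2 (apply_mem_antiSpace hk ξ)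

theorem antiCompl_mul {k : V →L[ℝ] V} (hk : k ∈ antiCommutant S J) : antiCompl S J * k = 0 := by
  rw [antiCompl, sub_mul, one_mul, starProjection_mul_of_mem_anti hk, sub_self]

theorem star_antiCompl : star (antiCompl S J) = antiCompl S J := by
  rw [antiCompl, star_sub, star_one, (isSelfAdjoint_starProjection _).star_eq]

theorem antiCompl_mul_self : antiCompl S J * antiCompl S J = antiCompl S J :=
  (Submodule.isIdempotentElem_starProjection (antiSpace S J)).one_sub

/-- The ranges of the anticommutant span a dense subspace of `antiSpace`, so the two hypotheses test
`s` and `t` on complementary subspaces. The identities for conjugates below are checked on these two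
pieces. -/
theorem antiCommutant_ext {s t : V →L[ℝ] V} (h : ∀ k ∈ antiCommutant S J, s * k = t * k)
    (h' : s * antiCompl S J = t * antiCompl S J) : s = t := by
  have hN : ∀ v ∈ antiSpace S J, s v = t v := by
    intro v hv
    refine closure_minimal (s := (LinearMap.range (antiSum S J) : Set V))
      (t := {v | s v = t v}) ?_ (isClosed_eq s.continuous t.continuous) hv
    rintro _ ⟨u, rfl⟩
    change s _ = t _
    induction u using Finsupp.induction_linear with
    | zero => simp
    | add f g hf hg => simp only [map_add, hf, hg]
    | single k ξ => simpa using congrArg (fun r => r ξ) (h k k.2)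
  ext v
  have h1 := hN _ (Submodule.starProjection_apply_mem (antiSpace S J) v)
  have h2 := congrArg (fun r => r v) h'
  simp only [antiCompl, mul_apply_eq_comp, sub_apply,
    one_apply_eq_self, map_sub, h1] at h2
  exact sub_left_injective h2

theorem star_mem_antiCommutant (hS : ∀ a ∈ S, star a = a) (hJ : star J = -J) {k : V →L[ℝ] V}
    (hk : k ∈ antiCommutant S J) : star k ∈ antiCommutant S J := by
  refine ⟨fun a ha => ?_, ?_⟩
  · have := congrArg star (hk.1 a ha)
    rw [star_mul, star_mul, hS a ha] at this
    exact this.symm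
  · have := congrArg star (hk.2)
    rw [star_neg, star_mul, star_mul, hJ, neg_mul, mul_neg, neg_neg] at this
    exact this.symm

theorem mul_mem_linCommutant {k l : V →L[ℝ] V} (hk : k ∈ antiCommutant S J)
    (hl : l ∈ antiCommutant S J) : k * l ∈ linCommutant S J := by
  refine ⟨fun a ha => ?_, ?_⟩
  · rw [← mul_assoc, hk.1 a ha, mul_assoc, hl.1 a ha, mul_assoc]
  · rw [← mul_assoc, hk.2, neg_mul, mul_assoc, hl.2, mul_neg, neg_neg, mul_assoc]

theorem mul_mem_antiCommutant {k l : V →L[ℝ] V} (hk : k ∈ linCommutant S J)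
    (hl : l ∈ antiCommutant S J) : k * l ∈ antiCommutant S J := by
  refine ⟨fun a ha => ?_, ?_⟩
  · rw [← mul_assoc, hk.1 a ha, mul_assoc, hl.1 a ha, mul_assoc]
  · rw [← mul_assoc, hk.2, mul_assoc, hl.2, mul_neg, mul_assoc]

theorem star_mem_linCommutant (hS : ∀ a ∈ S, star a = a) (hJ : star J = -J) {k : V →L[ℝ] V}
    (hk : k ∈ linCommutant S J) : star k ∈ linCommutant S J := by
  refine ⟨fun a ha => ?_, ?_⟩
  · have := congrArg star (hk.1 a ha)
    rw [star_mul, star_mul, hS a ha] at this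
    exact this.symm
  · have := congrArg star (hk.2)
    rw [star_mul, star_mul, hJ, neg_mul, mul_neg, neg_inj] at this
    exact this.symm

theorem mul_antiCompl (hS : ∀ a ∈ S, star a = a) (hJ : star J = -J) {k : V →L[ℝ] V}
    (hk : k ∈ antiCommutant S J) : k * antiCompl S J = 0 := by
  have := congrArg star (antiCompl_mul (star_mem_antiCommutant hS hJ hk))
  rwa [star_mul, star_star, star_antiCompl, star_zero] at this

/-- `antiCompl` commutes with every operator `t` such that `t` and `star t` map the anticommutant
to operators with range in `antiSpace`. -/
theorem antiCompl_comm_of_invariant {t : V →L[ℝ] V}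
    (ht : ∀ k ∈ antiCommutant S J, ∀ ξ, t (k ξ) ∈ antiSpace S J)
    (ht' : ∀ k ∈ antiCommutant S J, ∀ ξ, star t (k ξ) ∈ antiSpace S J) :
    t * antiCompl S J = antiCompl S J * t := by
  have key : ∀ r : V →L[ℝ] V, (∀ k ∈ antiCommutant S J, ∀ ξ, r (k ξ) ∈ antiSpace S J) →
      ∀ m ∈ antiSpace S J, r m ∈ antiSpace S J := by
    intro r hr m hm
    refine closure_minimal (s := (LinearMap.range (antiSum S J) : Set V))
      (t := r ⁻¹' (antiSpace S J : Set V)) ?_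
      ((Submodule.isClosed_topologicalClosure _).preimage r.continuous) hm
    rintro _ ⟨u, rfl⟩
    change r _ ∈ antiSpace S J
    induction u using Finsupp.induction_linear with
    | zero => simp
    | add f g hf hg => simp only [map_add]; exact add_mem hf hg
    | single k ξ => simpa using hr k k.2 ξ
  ext g
  have := commute_starProjection_of_invariant (antiSpace S J) t (star t)
    (fun g h => by
      rw [ContinuousLinearMap.star_eq_adjoint, ContinuousLinearMap.adjoint_inner_right])
    (key t ht) (key _ ht') g
  simp [antiCompl, this]

theorem antiCompl_comm_of_mem (hS : ∀ a ∈ S, star a = a) {t : V →L[ℝ] V} (ht : t ∈ S) :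
    t * antiCompl S J = antiCompl S J * t := by
  have : ∀ k ∈ antiCommutant S J, ∀ ξ, t (k ξ) ∈ antiSpace S J := fun k hk ξ => by
    have := congrArg (fun r => r ξ) (hk.1 t ht)
    simp only [mul_apply_eq_comp] at this
    rw [this]
    exact apply_mem_antiSpace hk _
  exact antiCompl_comm_of_invariant this (by rwa [hS t ht])

theorem antiCompl_comm_of_mem_linCommutant (hS : ∀ a ∈ S, star a = a) (hJ : star J = -J)
    {t : V →L[ℝ] V} (ht : t ∈ linCommutant S J) :
    t * antiCompl S J = antiCompl S J * t :=
  antiCompl_comm_of_invariant (fun _ hk ξ => apply_mem_antiSpace (mul_mem_antiCommutant ht hk) ξ)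
    (fun _ hk ξ => apply_mem_antiSpace
      (mul_mem_antiCommutant (star_mem_linCommutant hS hJ ht) hk) ξ)

/-- `antiCompl` lies in the commutant of `S` and `J`. -/
theorem antiCompl_mem_linCommutant (hS : ∀ a ∈ S, star a = a) (hJ : star J = -J)
    (hSJ : ∀ a ∈ S, a * J = J * a) : antiCompl S J ∈ linCommutant S J :=
  ⟨fun _ ha => antiCompl_comm_of_mem hS ha,
    antiCompl_comm_of_mem_linCommutant hS hJ ⟨hSJ, rfl⟩⟩

/-- `z` is the conjugate of `x`: the two are intertwined by the anticommutant and coincide on the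
orthogonal complement of `antiSpace`. -/
structure IsOpConj (S : Set (V →L[ℝ] V)) (J x z : V →L[ℝ] V) : Prop where
  mul_anti : ∀ k ∈ antiCommutant S J, z * k = k * x
  mul_compl : z * antiCompl S J = x * antiCompl S J

theorem IsOpConj.mul (hS : ∀ a ∈ S, star a = a) (hJ : star J = -J) (hSJ : ∀ a ∈ S, a * J = J * a)
    {x z x' z' : V →L[ℝ] V} (h : IsOpConj S J x z) (h' : IsOpConj S J x' z')
    (hx' : ∀ t ∈ linCommutant S J, x' * t = t * x') :
    IsOpConj S J (x * x') (z * z') := by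
  refine ⟨fun k hk => ?_, ?_⟩
  · rw [mul_assoc, h'.mul_anti k hk, ← mul_assoc, h.mul_anti k hk, mul_assoc]
  · have := hx' _ (antiCompl_mem_linCommutant hS hJ hSJ)
    rw [mul_assoc, h'.mul_compl, this, ← mul_assoc, h.mul_compl, mul_assoc, ← this, mul_assoc]

/-- If `k` is in the anticommutant, so is `t k`; hence `z t k = t k x = t z k`. With `t = J` this
makes the conjugate complex linear. -/
theorem IsOpConj.comm_linCommutant (hS : ∀ a ∈ S, star a = a) (hJ : star J = -J)
    {x z t : V →L[ℝ] V} (h : IsOpConj S J x z)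
    (hx : ∀ t ∈ linCommutant S J, x * t = t * x) (ht : t ∈ linCommutant S J) : z * t = t * z := by
  refine antiCommutant_ext (S := S) (J := J) (fun k hk => ?_) ?_
  · rw [mul_assoc, h.mul_anti _ (mul_mem_antiCommutant ht hk), mul_assoc, mul_assoc,
      h.mul_anti k hk]
  · rw [mul_assoc, antiCompl_comm_of_mem_linCommutant hS hJ ht, ← mul_assoc, h.mul_compl,
      mul_assoc, ← antiCompl_comm_of_mem_linCommutant hS hJ ht, ← mul_assoc, hx t ht, mul_assoc,
      mul_assoc, h.mul_compl]

/-- For `k` in the anticommutant, `l k` lies in the linear commutant, so `l z k = l k x = x l k`; on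
the complement of `antiSpace` both sides vanish. -/
theorem IsOpConj.anti_mul (hS : ∀ a ∈ S, star a = a) (hJ : star J = -J) (hSJ : ∀ a ∈ S, a * J = J * a)
    {x z l : V →L[ℝ] V} (h : IsOpConj S J x z)
    (hx : ∀ t ∈ linCommutant S J, x * t = t * x) (hl : l ∈ antiCommutant S J) :
    l * z = x * l := by
  refine antiCommutant_ext (S := S) (J := J) (fun k hk => ?_) ?_
  · rw [mul_assoc, h.mul_anti k hk, ← mul_assoc, mul_assoc x, hx _ (mul_mem_linCommutant hl hk)]
  · rw [mul_assoc, h.mul_compl, hx _ (antiCompl_mem_linCommutant hS hJ hSJ), ← mul_assoc,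
      mul_antiCompl hS hJ hl, mul_assoc, mul_antiCompl hS hJ hl, zero_mul, mul_zero]

theorem IsOpConj.star_eq (hS : ∀ a ∈ S, star a = a) (hJ : star J = -J) (hSJ : ∀ a ∈ S, a * J = J * a)
    {x z : V →L[ℝ] V} (h : IsOpConj S J x z)
    (hx : ∀ t ∈ linCommutant S J, x * t = t * x) (hxs : star x = x) : star z = z := by
  have hF := antiCompl_mem_linCommutant hS hJ hSJ
  refine antiCommutant_ext (S := S) (J := J) (fun k hk => ?_) ?_
  · have := congrArg star (h.anti_mul hS hJ hSJ hx (star_mem_antiCommutant hS hJ hk))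
    rw [star_mul, star_mul, star_star, hxs] at this
    rw [this, h.mul_anti k hk]
  · have := congrArg star (h.comm_linCommutant hS hJ hx hF)
    rw [h.mul_compl, star_mul, star_mul, star_antiCompl, hxs, ← hx _ hF] at this
    rw [← this, h.mul_compl]

/-- The product `l* k` of two anticommutant elements lies in the linear commutant, so `x` passes
through it. This is the symmetry of `∑ k ξ_k ↦ ∑ k x ξ_k`, stated on formal sums before that map is
known to be well defined. -/
theorem inner_antiSum_mapRange (hS : ∀ a ∈ S, star a = a) (hJ : star J = -J)
    {x : V →L[ℝ] V} (hx : ∀ t ∈ linCommutant S J, x * t = t * x)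
    (hxs : star x = x) (u v : antiCommutant S J →₀ V) :
    inner ℝ (antiSum S J u) (antiSum S J (Finsupp.mapRange.linearMap x.toLinearMap v)) =
      inner ℝ (antiSum S J (Finsupp.mapRange.linearMap x.toLinearMap u)) (antiSum S J v) := by
  induction u using Finsupp.induction_linear with
  | zero => simp
  | add f g hf hg => simp only [map_add, inner_add_left, hf, hg]
  | single k ξ =>
    induction v using Finsupp.induction_linear with
    | zero => simp
    | add f g hf hg => simp only [map_add, inner_add_right, hf, hg]
    | single l η =>
      have h1 := congrArg (fun r => inner ℝ (r ξ) η)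
        (hx _ (mul_mem_linCommutant (star_mem_antiCommutant hS hJ l.2) k.2))
      simp only [mul_apply_eq_comp] at h1
      conv_lhs at h1 => rw [← hxs]
      rw [ContinuousLinearMap.star_eq_adjoint, ContinuousLinearMap.adjoint_inner_left,
        ContinuousLinearMap.star_eq_adjoint, ContinuousLinearMap.adjoint_inner_left,
        ContinuousLinearMap.adjoint_inner_left] at h1
      simpa using h1

/-- Existence of the conjugate of a self-adjoint `x`; the operator `y` bounds its norm by `c`. -/
theorem exists_isOpConj (hS : ∀ a ∈ S, star a = a) (hJ : star J = -J)
    {x y : V →L[ℝ] V} {c : ℝ} (hc : 0 ≤ c)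
    (hx : ∀ t ∈ linCommutant S J, x * t = t * x) (hxs : star x = x)
    (hy : ∀ t ∈ linCommutant S J, y * t = t * y) (hys : star y = y)
    (hxy : x * x + y * y = (c ^ 2) • (1 : V →L[ℝ] V)) : ∃ z, IsOpConj S J x z := by
  let X := Finsupp.mapRange.linearMap (α := antiCommutant S J) x.toLinearMap
  let Y := Finsupp.mapRange.linearMap (α := antiCommutant S J) y.toLinearMap
  have hXY : ∀ v, X (X v) + Y (Y v) = (c ^ 2) • v := by
    intro v
    ext k
    simpa [X, Y] using congrArg (fun r => r (v k)) hxy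
  -- By symmetry and `x² + y² = c²`, one has `‖∑ k x ξ_k‖² + ‖∑ k y ξ_k‖² = c² ‖∑ k ξ_k‖²`. The
  -- bound gives well-definedness as well as continuity.
  have hbound : ∀ v, ‖antiSum S J (X v)‖ ≤ c * ‖antiSum S J v‖ := by
    intro v
    have h1 := inner_antiSum_mapRange hS hJ hx hxs (X v) v
    have h2 := inner_antiSum_mapRange hS hJ hy hys (Y v) v
    have h3 := congrArg (fun w => inner ℝ (antiSum S J w) (antiSum S J v)) (hXY v)
    simp only [map_add, inner_add_left, map_smul, inner_smul_left] at h3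
    change inner ℝ (antiSum S J (X v)) (antiSum S J (X v)) = inner ℝ (antiSum S J (X (X v))) _ at h1
    change inner ℝ (antiSum S J (Y v)) (antiSum S J (Y v)) = inner ℝ (antiSum S J (Y (Y v))) _ at h2
    rw [← h1, ← h2] at h3
    simp only [real_inner_self_eq_norm_sq] at h3
    refine abs_le_of_sq_le_sq' ?_ (by positivity) |>.2
    rw [mul_pow]
    have : (starRingEnd ℝ) (c ^ 2) = c ^ 2 := rfl
    rw [this] at h3
    nlinarith [sq_nonneg ‖antiSum S J (Y v)‖]
  let i : (antiCommutant S J →₀ V) →ₗ[ℝ] antiSpace S J :=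
    (antiSum S J).codRestrict _ fun v => Submodule.le_topologicalClosure _ ⟨v, rfl⟩
  have hdense : DenseRange i := by
    rw [DenseRange, Subtype.dense_iff]
    intro v hv
    have : Subtype.val '' Set.range i = (LinearMap.range (antiSum S J) : Set V) := by
      rw [← Set.range_comp]; rfl
    exact (congrArg (v ∈ closure ·) this).mpr hv
  let z₀ : antiSpace S J →L[ℝ] V := ((antiSum S J).comp X).extendOfNorm i
  have hz₀ : ∀ v, z₀ (i v) = antiSum S J (X v) := fun v =>
    LinearMap.extendOfNorm_eq hdense ⟨c, hbound⟩ v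
  refine ⟨z₀ ∘L (antiSpace S J).orthogonalProjectionOnto + x * antiCompl S J, fun k hk => ?_, ?_⟩
  · rw [add_mul, mul_assoc x, antiCompl_mul hk, mul_zero, add_zero]
    ext ξ
    have h1 : (antiSpace S J).orthogonalProjectionOnto (k ξ) = i (Finsupp.single ⟨k, hk⟩ ξ) := by
      apply Subtype.ext
      have := Submodule.starProjection_eq_self_iff.2 (apply_mem_antiSpace hk ξ)
      rw [Submodule.starProjection_apply] at this
      rw [this]
      exact (antiSum_single ⟨k, hk⟩ ξ).symm
    have h2 := hz₀ (Finsupp.single ⟨k, hk⟩ ξ)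
    rw [← h1] at h2
    simpa [X] using h2
  · rw [add_mul, mul_assoc x, antiCompl_mul_self]
    convert zero_add _
    ext ξ
    have : (antiSpace S J).orthogonalProjectionOnto (antiCompl S J ξ) = 0 := by
      apply Subtype.ext
      rw [← Submodule.starProjection_apply]
      have := Submodule.isIdempotentElem_starProjection (antiSpace S J)
      simpa [antiCompl, sub_eq_zero] using congrArg (fun r => r ξ) this.eq.symm
    simp [this]

end Conjugation

/-! ### Complex operators viewed as real ones, and the envelopes of `A` -/

section Complex

attribute [local instance] InnerProductSpace.complexToReal

theorem IsWOTClosed.mem_of_tendsto {S : Set (H →L[ℂ] H)} (hS : IsWOTClosed S) {α : Type*}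
    {l : Filter α} [l.NeBot] {s : α → H →L[ℂ] H} (hs : ∀ i, s i ∈ S) {x : H →L[ℂ] H}
    (h : ∀ ξ, Tendsto (fun i => s i ξ) l (𝓝 (x ξ))) : x ∈ S := by
  have : Tendsto (fun i => ContinuousLinearMapWOT.ofCLM (s i)) l
      (𝓝 (ContinuousLinearMapWOT.ofCLM x)) := by
    rw [ContinuousLinearMapWOT.tendsto_iff_forall_inner_apply_tendsto]
    exact fun ξ η => (continuous_const.inner continuous_id).continuousAt.tendsto.comp (h ξ)
  exact IsClosed.mem_of_tendsto (s := {T : H →WOT[ℂ] H | T.toCLM ∈ S}) hS this (Eventually.of_forall hs)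

/-- The approximants form a net indexed by a finite set of vectors and a precision `1 / (n + 1)`; it
converges strongly, hence weakly. -/
theorem IsWOTClosed.mem_of_approx {S : Set (H →L[ℂ] H)} (hS : IsWOTClosed S) {x : H →L[ℂ] H}
    (h : ∀ (n : ℕ) (ξ : Fin n → H) (ε : ℝ), 0 < ε → ∃ s ∈ S, ∀ i, ‖s (ξ i) - x (ξ i)‖ < ε) :
    x ∈ S := by
  classical
  have : ∀ i : Finset H × ℕ, ∃ s ∈ S, ∀ ξ ∈ i.1, ‖s ξ - x ξ‖ < 1 / ((i.2 : ℝ) + 1) := by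
    rintro ⟨F, n⟩
    obtain ⟨s, hs, hs'⟩ := h F.card (fun i => (F.equivFin.symm i : H)) (1 / ((n : ℝ) + 1))
      (by positivity)
    exact ⟨s, hs, fun ξ hξ => by simpa using hs' (F.equivFin ⟨ξ, hξ⟩)⟩
  choose s hs hs' using this
  refine hS.mem_of_tendsto (l := atTop) hs fun ξ => ?_
  rw [tendsto_iff_norm_sub_tendsto_zero]
  have h0 : Tendsto (fun i : Finset H × ℕ => 1 / ((i.2 : ℝ) + 1)) atTop (𝓝 0) :=
    tendsto_one_div_add_atTop_nhds_zero_nat.comp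
      (by rw [← prod_atTop_atTop_eq]; exact tendsto_snd)
  refine squeeze_zero' (Eventually.of_forall fun _ => norm_nonneg _) ?_ h0
  filter_upwards [eventually_ge_atTop (({ξ} : Finset H), 0)] with i hi
  exact (hs' i ξ (hi.1 (Finset.mem_singleton_self ξ))).le

theorem star_list_prod_of_selfAdjoint {R : Type*} [Semiring R] [StarRing R] (l : List R)
    (hl : ∀ a ∈ l, IsSelfAdjoint a) : star l.prod = l.reverse.prod := by
  induction l with
  | nil => simp
  | cons a l ih =>
    rw [List.prod_cons, star_mul, ih fun b hb => hl b (List.mem_cons_of_mem _ hb),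
      (hl a List.mem_cons_self).star_eq]
    simp

/-- In a reversible JW-algebra the real parts of the elements of the generated real `*`-algebra
belong to the algebra. -/
theorem add_star_mem_of_mem_adjoin {A : Submodule ℝ (H →L[ℂ] H)} (hA : IsJWAlgebra A)
    (hrev : IsReversible A) {r : H →L[ℂ] H}
    (hr : r ∈ NonUnitalStarAlgebra.adjoin ℝ (A : Set (H →L[ℂ] H))) : r + star r ∈ A := by
  have hst : (A : Set (H →L[ℂ] H)) ∪ star (A : Set (H →L[ℂ] H)) = A := by
    refine Set.union_eq_left.2 fun a ha => ?_
    have h1 : star a ∈ A := ha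
    have := (hA.selfAdjoint _ h1).star_eq
    rw [star_star] at this
    exact this ▸ h1
  have hr' : r ∈ Submodule.span ℝ (Subsemigroup.closure (A : Set (H →L[ℂ] H)) :
      Set (H →L[ℂ] H)) := by
    have := NonUnitalStarAlgebra.adjoin_eq_span (R := ℝ) (A : Set (H →L[ℂ] H))
    rw [hst] at this
    rw [← this]
    exact hr
  clear hr
  induction hr' using Submodule.span_induction with
  | zero => simp
  | add x y _ _ hx hy =>
    rw [star_add, add_add_add_comm]
    exact add_mem hx hy
  | smul c x _ hx =>
    rw [star_smul, star_trivial, ← smul_add]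
    exact A.smul_mem c hx
  | mem x hx =>
    have hl : ∃ l : List (H →L[ℂ] H), l ≠ [] ∧ (∀ a ∈ l, a ∈ A) ∧ l.prod = x := by
      induction hx using Subsemigroup.closure_induction with
      | mem a ha => exact ⟨[a], by simp, by simpa using ha, by simp⟩
      | mul a b _ _ ha hb =>
        obtain ⟨l, hl, hlA, rfl⟩ := ha
        obtain ⟨m, _, hmA, rfl⟩ := hb
        refine ⟨l ++ m, by simp [hl], fun a ha => ?_, by simp⟩
        exact (List.mem_append.1 ha).elim (hlA a) (hmA a)
    obtain ⟨l, hl, hlA, rfl⟩ := hl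
    rw [star_list_prod_of_selfAdjoint l fun a ha => hA.selfAdjoint a (hlA a ha)]
    exact hrev l hl hlA

theorem restrictScalars_star (x : H →L[ℂ] H) :
    (star x).restrictScalars ℝ = star (x.restrictScalars ℝ) := by
  rw [ContinuousLinearMap.star_eq_adjoint, ContinuousLinearMap.star_eq_adjoint,
    ContinuousLinearMap.eq_adjoint_iff]
  intro ξ η
  rw [real_inner_eq_re_inner ℂ, real_inner_eq_re_inner ℂ]
  exact congrArg Complex.re (ContinuousLinearMap.adjoint_inner_left x η ξ)

/-- Multiplication by the imaginary unit, as a real operator. -/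
def mulI (H : Type*) [NormedAddCommGroup H] [InnerProductSpace ℂ H] : H →L[ℝ] H :=
  (Complex.I • (1 : H →L[ℂ] H)).restrictScalars ℝ

@[simp]
theorem mulI_apply (ξ : H) : mulI H ξ = Complex.I • ξ := rfl

theorem mulI_mul_mulI : mulI H * mulI H = -1 := by
  ext ξ
  simp [smul_smul]

theorem star_mulI : star (mulI H) = -mulI H := by
  rw [mulI, ← restrictScalars_star, star_smul, star_one]
  ext ξ
  simp

theorem exists_restrictScalars_eq {t : H →L[ℝ] H} (ht : mulI H * t = t * mulI H) :
    ∃ x : H →L[ℂ] H, x.restrictScalars ℝ = t := by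
  refine ⟨⟨⟨⟨t, map_add t⟩, fun c ξ => ?_⟩, t.continuous⟩, rfl⟩
  have h1 : ∀ ξ, t (Complex.I • ξ) = Complex.I • t ξ := fun ξ =>
    (congrArg (fun r => r ξ) ht).symm
  have h2 : ∀ η : H, c • η = c.re • η + c.im • Complex.I • η := by
    intro η
    conv_lhs => rw [← Complex.re_add_im c]
    rw [add_smul, mul_smul]
    rfl
  simp only [RingHom.id_apply]
  rw [h2 ξ, h2 (t ξ), map_add, map_smul, map_smul, h1]

theorem restrictScalars_injective {x y : H →L[ℂ] H}
    (h : x.restrictScalars ℝ = y.restrictScalars ℝ) : x = y := by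
  ext ξ
  exact congrArg (fun r => r ξ) h

theorem restrictScalars_mul (x y : H →L[ℂ] H) :
    (x * y).restrictScalars ℝ = x.restrictScalars ℝ * y.restrictScalars ℝ := rfl

/-- The JW-algebra `A`, as a set of real operators. -/
def realOps (A : Submodule ℝ (H →L[ℂ] H)) : Set (H →L[ℝ] H) :=
  (ContinuousLinearMap.restrictScalars ℝ) '' (A : Set (H →L[ℂ] H))

theorem star_eq_of_mem_realOps {A : Submodule ℝ (H →L[ℂ] H)} (hA : IsJWAlgebra A) :
    ∀ a ∈ realOps A, star a = a := by
  rintro _ ⟨a, ha, rfl⟩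
  rw [← restrictScalars_star, (hA.selfAdjoint a ha).star_eq]

theorem mul_mulI_of_mem_realOps {A : Submodule ℝ (H →L[ℂ] H)} :
    ∀ a ∈ realOps A, a * mulI H = mulI H * a := by
  rintro _ ⟨a, ha, rfl⟩
  ext ξ
  simp

/-- The real operators commuting with `A`. -/
def realCommutant (A : Submodule ℝ (H →L[ℂ] H)) : Set (H →L[ℝ] H) :=
  {k | ∀ a ∈ realOps A, a * k = k * a}

theorem star_mem_realCommutant {A : Submodule ℝ (H →L[ℂ] H)} (hA : IsJWAlgebra A) {k : H →L[ℝ] H}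
    (hk : k ∈ realCommutant A) : star k ∈ realCommutant A := by
  intro a ha
  have := congrArg star (hk a ha)
  rw [star_mul, star_mul, star_eq_of_mem_realOps hA a ha] at this
  exact this.symm

/-- An operator in the real bicommutant of `A` that is supported by the unit of `A` can be
approximated strongly by the real algebra generated by `A`. -/
theorem exists_adjoin_approx {A : Submodule ℝ (H →L[ℂ] H)} {e : H →L[ℂ] H} (he : e ∈ A)
    {x : H →L[ℂ] H} (hx : ∀ k ∈ realCommutant A, x.restrictScalars ℝ * k = k * x.restrictScalars ℝ)
    (hxe : x * e = x) (n : ℕ) (ξ : Fin n → H) (ε : ℝ) (hε : 0 < ε) :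
    ∃ r ∈ NonUnitalStarAlgebra.adjoin ℝ (A : Set (H →L[ℂ] H)), ∀ i, ‖r (ξ i) - x (ξ i)‖ < ε := by
  let B := NonUnitalStarAlgebra.adjoin ℝ (A : Set (H →L[ℂ] H))
  let R : Submodule ℝ (H →L[ℝ] H) :=
    B.toNonUnitalSubalgebra.toSubmodule.map (ContinuousLinearMap.restrictScalarsₗ ℂ H H ℝ ℝ)
  have hAB : (A : Set (H →L[ℂ] H)) ⊆ B := NonUnitalStarAlgebra.subset_adjoin ℝ _
  obtain ⟨_, ⟨r, hr, rfl⟩, h⟩ := exists_approx_of_mem_bicommutant R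
    (by rintro _ ⟨r, hr, rfl⟩ _ ⟨s, hs, rfl⟩
        exact ⟨r * s, mul_mem (s := B) hr hs, rfl⟩)
    (by rintro _ ⟨r, hr, rfl⟩
        exact ⟨star r, star_mem (s := B) hr, restrictScalars_star r⟩)
    (e := e.restrictScalars ℝ) ⟨e, hAB he, rfl⟩ (x.restrictScalars ℝ)
    (fun k hk => hx k (by
      rintro _ ⟨a, ha, rfl⟩
      exact hk _ ⟨a, hAB ha, rfl⟩)) ξ hε
  refine ⟨r, hr, fun i => ?_⟩
  have h1 : x (e (ξ i)) = x (ξ i) := congrArg (fun t => t (ξ i)) hxe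
  have := h i
  rw [← h1]
  exact this

theorem mem_realEnvelope_of_bicommutant {A : Submodule ℝ (H →L[ℂ] H)} {e : H →L[ℂ] H} (he : e ∈ A)
    {x : H →L[ℂ] H} (hx : ∀ k ∈ realCommutant A, x.restrictScalars ℝ * k = k * x.restrictScalars ℝ)
    (hxe : x * e = x) : x ∈ realEnvelope A := by
  refine NonUnitalStarAlgebra.mem_sInf.2 fun B hB => hB.2.mem_of_approx fun n ξ ε hε => ?_
  obtain ⟨r, hr, h⟩ := exists_adjoin_approx he hx hxe n ξ ε hε
  exact ⟨r, NonUnitalStarAlgebra.adjoin_le hB.1 hr, h⟩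

/-- Approximation alone only gives the generated real algebra. Reversibility puts the real parts of
that algebra in `A`, and the condition `(T + T*) / 2 ∈ A` is weakly closed because the adjoint is
weakly continuous. -/
theorem mem_of_bicommutant {A : Submodule ℝ (H →L[ℂ] H)} (hA : IsJWAlgebra A)
    (hrev : IsReversible A) {e : H →L[ℂ] H} (he : e ∈ A)
    {x : H →L[ℂ] H} (hx : ∀ k ∈ realCommutant A, x.restrictScalars ℝ * k = k * x.restrictScalars ℝ)
    (hxe : x * e = x) (hxs : IsSelfAdjoint x) : x ∈ A := by
  have hcl : IsWOTClosed {T : H →L[ℂ] H | (1 / 2 : ℝ) • (T + star T) ∈ A} := by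
    have hc : Continuous fun T : H →WOT[ℂ] H => (1 / 2 : ℝ) • (T + star T) :=
      (continuous_id.add continuous_star).const_smul (1 / 2 : ℝ)
    exact IsClosed.preimage hc hA.closed
  have : (1 / 2 : ℝ) • (x + star x) ∈ A := by
    refine hcl.mem_of_approx fun n ξ ε hε => ?_
    obtain ⟨r, hr, h⟩ := exists_adjoin_approx he hx hxe n ξ ε hε
    exact ⟨r, A.smul_mem _ (add_star_mem_of_mem_adjoin hA hrev hr), h⟩
  rwa [hxs.star_eq, ← two_smul ℝ x, smul_smul, one_div, inv_mul_cancel₀ two_ne_zero,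
    one_smul] at this

theorem commute_of_mem_realEnvelope {A : Submodule ℝ (H →L[ℂ] H)} (hA : IsJWAlgebra A)
    {x : H →L[ℂ] H} (hx : x ∈ realEnvelope A) {k : H →L[ℝ] H} (hk : k ∈ realCommutant A) :
    x.restrictScalars ℝ * k = k * x.restrictScalars ℝ := by
  let B : NonUnitalStarSubalgebra ℝ (H →L[ℂ] H) :=
    { carrier := {y | ∀ k ∈ realCommutant A,
        y.restrictScalars ℝ * k = k * y.restrictScalars ℝ}
      add_mem' := fun {y z} hy hz k hk => by
        have h1 := hy k hk
        have h2 := hz k hk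
        have h3 : (y + z).restrictScalars ℝ = y.restrictScalars ℝ + z.restrictScalars ℝ := rfl
        rw [h3, add_mul, mul_add, h1, h2]
      zero_mem' := fun k _ => by
        have : (0 : H →L[ℂ] H).restrictScalars ℝ = 0 := rfl
        rw [this, zero_mul, mul_zero]
      mul_mem' := fun {y z} hy hz k hk => by
        rw [restrictScalars_mul, mul_assoc, hz k hk, ← mul_assoc, hy k hk, mul_assoc]
      smul_mem' := fun c y hy k hk => by
        have h3 : (c • y).restrictScalars ℝ = c • y.restrictScalars ℝ := rfl
        rw [h3, smul_mul_assoc, hy k hk, mul_smul_comm]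
      star_mem' := fun {y} hy k hk => by
        have := congrArg star (hy _ (star_mem_realCommutant hA hk))
        rw [star_mul, star_mul, star_star, ← restrictScalars_star] at this
        exact this.symm }
  refine NonUnitalStarAlgebra.mem_sInf.1 hx B ⟨fun a ha k hk => hk _ ⟨a, ha, rfl⟩, ?_⟩ k hk
  -- As `k` is only real linear, commutation is tested by real parts of inner products, each of
  -- which is weakly continuous in `T`.
  have : {T : H →WOT[ℂ] H | T.toCLM ∈ (B : Set (H →L[ℂ] H))} =
      ⋂ k ∈ realCommutant A, ⋂ ξ : H, ⋂ η : H,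
        {T : H →WOT[ℂ] H | (inner ℂ η (T (k ξ))).re = (inner ℂ (star k η) (T ξ)).re} := by
    ext T
    simp only [Set.mem_iInter, Set.mem_ofPred_eq]
    have key : ∀ (k : H →L[ℝ] H) (ξ η : H), (inner ℂ (star k η) (T ξ)).re = inner ℝ η (k (T ξ)) := by
      intro k ξ η
      rw [← ContinuousLinearMap.adjoint_inner_left]
      rfl
    refine forall₂_congr fun k _ => ⟨fun h ξ η => ?_, fun h => ?_⟩
    · rw [key]
      exact congrArg (fun r => inner ℝ η (r ξ)) h
    · ext ξ
      refine ext_inner_left ℝ fun η => ?_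
      have := h ξ η
      rw [key] at this
      exact this
  rw [IsWOTClosed, this]
  have hc : ∀ ξ η : H, Continuous fun T : H →WOT[ℂ] H => (inner ℂ η (T ξ)).re := fun ξ η =>
    Complex.continuous_re.comp
      (ContinuousLinearMapWOT.continuous_dual_apply ξ (innerSL ℂ η))
  exact isClosed_iInter fun k => isClosed_iInter fun _ => isClosed_iInter fun ξ =>
    isClosed_iInter fun η => isClosed_eq (hc _ _) (hc _ _)

/-- The easy half of the double commutant theorem: the commutant of `{t, t*}` is a weakly closed
`*`-algebra containing `A`. -/
theorem commute_of_mem_envelope {A : Submodule ℝ (H →L[ℂ] H)} (hA : IsJWAlgebra A)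
    {x : H →L[ℂ] H} (hx : x ∈ envelope A) {t : H →L[ℂ] H} (ht : ∀ a ∈ A, a * t = t * a) :
    x * t = t * x := by
  have ht' : ∀ a ∈ A, a * star t = star t * a := fun a ha => by
    have := congrArg star (ht a ha)
    rw [star_mul, star_mul, (hA.selfAdjoint a ha).star_eq] at this
    exact this.symm
  let B := (StarSubalgebra.centralizer ℂ {t}).toNonUnitalStarSubalgebra
  have hB : ∀ y, y ∈ B ↔ t * y = y * t ∧ star t * y = y * star t := fun y => by
    change y ∈ StarSubalgebra.centralizer ℂ {t} ↔ _
    simp [StarSubalgebra.mem_centralizer_iff]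
  refine ((hB x).1 (NonUnitalStarAlgebra.mem_sInf.1 hx B
    ⟨fun a ha => (hB a).2 ⟨(ht a ha).symm, (ht' a ha).symm⟩, ?_⟩)).1.symm
  have : {T : H →WOT[ℂ] H | T.toCLM ∈ (B : Set (H →L[ℂ] H))} =
      {T | ContinuousLinearMapWOT.ofCLM t * T = T * ContinuousLinearMapWOT.ofCLM t} ∩
      {T | ContinuousLinearMapWOT.ofCLM (star t) * T =
        T * ContinuousLinearMapWOT.ofCLM (star t)} := by
    ext T
    refine (hB T.toCLM).trans ?_
    constructor
    · rintro ⟨h1, h2⟩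
      exact ⟨ContinuousLinearMapWOT.toCLM_injective h1, ContinuousLinearMapWOT.toCLM_injective h2⟩
    · rintro ⟨h1, h2⟩
      exact ⟨congrArg ContinuousLinearMapWOT.toCLM h1, congrArg ContinuousLinearMapWOT.toCLM h2⟩
  rw [IsWOTClosed, this]
  exact (isClosed_eq (continuous_const_mul _) (continuous_mul_const _)).inter
    (isClosed_eq (continuous_const_mul _) (continuous_mul_const _))

theorem mul_unit_of_mem_envelope {A : Submodule ℝ (H →L[ℂ] H)} (hA : IsJWAlgebra A)
    {e : H →L[ℂ] H} (he : e ∈ A) (hunit : ∀ a ∈ A, e * a = a ∧ a * e = a) {x : H →L[ℂ] H}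
    (hx : x ∈ envelope A) : x * e = x := by
  let B : NonUnitalStarSubalgebra ℂ (H →L[ℂ] H) :=
    { carrier := {y | y * e = y ∧ e * y = y}
      add_mem' := fun {y z} hy hz => by simp [add_mul, mul_add, hy.1, hz.1, hy.2, hz.2]
      zero_mem' := by simp
      mul_mem' := fun {y z} hy hz => ⟨by rw [mul_assoc, hz.1], by rw [← mul_assoc, hy.2]⟩
      smul_mem' := fun c y hy => by simp [hy.1, hy.2]
      star_mem' := fun {y} hy => by
        have he' := (hA.selfAdjoint e he).star_eq
        exact ⟨by simpa [he'] using congrArg star hy.2, by simpa [he'] using congrArg star hy.1⟩ }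
  refine (NonUnitalStarAlgebra.mem_sInf.1 hx B ⟨fun a ha => (hunit a ha).symm, ?_⟩).1
  have : {T : H →WOT[ℂ] H | T.toCLM ∈ (B : Set (H →L[ℂ] H))} =
      {T | T * ContinuousLinearMapWOT.ofCLM e = T} ∩
      {T | ContinuousLinearMapWOT.ofCLM e * T = T} := by
    ext T
    constructor
    · rintro ⟨h1, h2⟩
      exact ⟨ContinuousLinearMapWOT.toCLM_injective h1, ContinuousLinearMapWOT.toCLM_injective h2⟩
    · rintro ⟨h1, h2⟩
      exact ⟨congrArg ContinuousLinearMapWOT.toCLM h1, congrArg ContinuousLinearMapWOT.toCLM h2⟩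
  rw [IsWOTClosed, this]
  exact (isClosed_eq (continuous_mul_const _) continuous_id).inter
    (isClosed_eq (continuous_const_mul _) continuous_id)

end Complex

/-! ### The decomposition `x = a + i b` and the bound `x ≤ 2a` -/

section Decomposition

attribute [local instance] InnerProductSpace.complexToReal

theorem commute_linCommutant_of_commute {A : Submodule ℝ (H →L[ℂ] H)} {x : H →L[ℂ] H}
    (hx : ∀ t : H →L[ℂ] H, (∀ a ∈ A, a * t = t * a) → x * t = t * x) :
    ∀ t ∈ linCommutant (realOps A) (mulI H),
      x.restrictScalars ℝ * t = t * x.restrictScalars ℝ := by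
  intro t ht
  obtain ⟨t', rfl⟩ := exists_restrictScalars_eq ht.2
  rw [← restrictScalars_mul, hx t' fun a ha => restrictScalars_injective (ht.1 _ ⟨a, ha, rfl⟩)]
  rfl

/-- Every positive operator `x` in the bicommutant of `A` has a positive conjugate. -/
theorem exists_nonneg_isOpConj {A : Submodule ℝ (H →L[ℂ] H)} (hA : IsJWAlgebra A) {x : H →L[ℂ] H}
    (hx0 : 0 ≤ x) (hx : ∀ t : H →L[ℂ] H, (∀ a ∈ A, a * t = t * a) → x * t = t * x) :
    ∃ z : H →L[ℂ] H, 0 ≤ z ∧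
      IsOpConj (realOps A) (mulI H) (x.restrictScalars ℝ) (z.restrictScalars ℝ) := by
  have hS := star_eq_of_mem_realOps hA
  have hSJ := mul_mulI_of_mem_realOps (A := A)
  -- The root is conjugated rather than `x`: the conjugate `v'` of `w` is self-adjoint, so the
  -- conjugate `v' * v'` of `x` is positive. The companion `y`, with `w² + y² = ‖x‖`, supplies the
  -- norm bound.
  set w := CFC.sqrt x with hw
  have hww : w * w = x := CFC.sqrt_mul_sqrt_self x hx0
  have hw0 : 0 ≤ w := CFC.sqrt_nonneg x
  have hv0 : 0 ≤ algebraMap ℝ (H →L[ℂ] H) ‖x‖ - x :=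
    sub_nonneg.2 (IsSelfAdjoint.of_nonneg hx0).le_algebraMap_norm_self
  set y := CFC.sqrt (algebraMap ℝ (H →L[ℂ] H) ‖x‖ - x) with hy
  have hyy : y * y = algebraMap ℝ (H →L[ℂ] H) ‖x‖ - x := CFC.sqrt_mul_sqrt_self _ hv0
  have hy0 : 0 ≤ y := CFC.sqrt_nonneg _
  have hwc : ∀ t : H →L[ℂ] H, (∀ a ∈ A, a * t = t * a) → w * t = t * w := fun t ht =>
    (Commute.cfcₙ_nnreal (show Commute x t from hx t ht) NNReal.sqrt).eq
  have hyc : ∀ t : H →L[ℂ] H, (∀ a ∈ A, a * t = t * a) → y * t = t * y := fun t ht =>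
    (Commute.cfcₙ_nnreal (show Commute (algebraMap ℝ (H →L[ℂ] H) ‖x‖ - x) t from
      (Algebra.commute_algebraMap_left ‖x‖ t).sub_left (hx t ht))
      NNReal.sqrt).eq
  have hws : star (w.restrictScalars ℝ) = w.restrictScalars ℝ := by
    rw [← restrictScalars_star, (IsSelfAdjoint.of_nonneg hw0).star_eq]
  have hys : star (y.restrictScalars ℝ) = y.restrictScalars ℝ := by
    rw [← restrictScalars_star, (IsSelfAdjoint.of_nonneg hy0).star_eq]
  have hwc' := commute_linCommutant_of_commute hwc
  have hsum : w.restrictScalars ℝ * w.restrictScalars ℝ +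
      y.restrictScalars ℝ * y.restrictScalars ℝ = (√‖x‖ ^ 2) • (1 : H →L[ℝ] H) := by
    rw [← restrictScalars_mul, ← restrictScalars_mul, hww, hyy, Real.sq_sqrt (norm_nonneg x)]
    ext ξ
    simp [Algebra.algebraMap_eq_smul_one]
  obtain ⟨v, hv⟩ := exists_isOpConj hS star_mulI (Real.sqrt_nonneg ‖x‖) hwc' hws
    (commute_linCommutant_of_commute hyc) hys hsum
  have hJ : mulI H ∈ linCommutant (realOps A) (mulI H) := ⟨hSJ, rfl⟩
  obtain ⟨v', rfl⟩ := exists_restrictScalars_eq (hv.comm_linCommutant hS star_mulI hwc' hJ).symm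
  have hvs : star v' = v' := restrictScalars_injective (by
    rw [restrictScalars_star, hv.star_eq hS star_mulI hSJ hwc' hws])
  refine ⟨v' * v', ?_, ?_⟩
  · conv_rhs => rw [← hvs]
    nth_rw 2 [hvs]
    exact star_mul_self_nonneg v'
  · rw [← hww]
    exact hv.mul hS star_mulI hSJ hv hwc'

/-- A real operator commuting with `A` is the sum of a complex linear and a conjugate linear one. -/
theorem exists_lin_add_anti {A : Submodule ℝ (H →L[ℂ] H)} {k : H →L[ℝ] H}
    (hk : k ∈ realCommutant A) : ∃ p ∈ linCommutant (realOps A) (mulI H),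
      ∃ q ∈ antiCommutant (realOps A) (mulI H), k = p + q := by
  have hJk : ∀ a ∈ realOps A, a * (mulI H * k * mulI H) = mulI H * k * mulI H * a := by
    intro a ha
    have hJ := mul_mulI_of_mem_realOps a ha
    rw [mul_assoc (mulI H * k), ← hJ, ← mul_assoc, ← mul_assoc, ← mul_assoc, hJ, mul_assoc _ a k,
      hk a ha, ← mul_assoc]
  have hJJ := mulI_mul_mulI (H := H)
  have h1 : mulI H * (mulI H * k * mulI H) = -(k * mulI H) := by
    rw [← mul_assoc, ← mul_assoc, hJJ, neg_one_mul, neg_mul]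
  have h2 : mulI H * k * mulI H * mulI H = -(mulI H * k) := by
    rw [mul_assoc, hJJ, mul_neg_one]
  refine ⟨(1 / 2 : ℝ) • (k - mulI H * k * mulI H), ⟨fun a ha => ?_, ?_⟩,
    (1 / 2 : ℝ) • (k + mulI H * k * mulI H), ⟨fun a ha => ?_, ?_⟩, ?_⟩
  · rw [mul_smul_comm, smul_mul_assoc, mul_sub, sub_mul, hJk a ha, hk a ha]
  · rw [mul_smul_comm, smul_mul_assoc, mul_sub, sub_mul, h1, h2]
    congr 1
    abel
  · rw [mul_smul_comm, smul_mul_assoc, mul_add, add_mul, hJk a ha, hk a ha]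
  · rw [mul_smul_comm, smul_mul_assoc, mul_add, add_mul, h1, h2, ← smul_neg]
    congr 1
    abel
  · rw [← smul_add, sub_add_add_cancel, ← two_smul ℝ k, smul_smul]
    norm_num

/-- Elements of `R(A) ∩ i R(A)` live on the complement of `antiSpace`. -/
theorem antiCompl_mul_of_mem_inter {A : Submodule ℝ (H →L[ℂ] H)} (hA : IsJWAlgebra A)
    {y : H →L[ℂ] H} (hy : y ∈ realEnvelope A) (hIy : Complex.I • y ∈ realEnvelope A) :
    antiCompl (realOps A) (mulI H) * y.restrictScalars ℝ = y.restrictScalars ℝ := by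
  have key : ∀ u ∈ realEnvelope A, Complex.I • u ∈ realEnvelope A →
      u.restrictScalars ℝ * antiCompl (realOps A) (mulI H) = u.restrictScalars ℝ := by
    intro u hu hIu
    refine antiCommutant_ext (S := realOps A) (J := mulI H) (fun k hk => ?_) ?_
    · rw [mul_assoc, antiCompl_mul hk, mul_zero]
      -- Both `u` and `i u` commute with the conjugate linear `k`, so `i u k = k i u = -i k u = -i u
      -- k`, and `u k = 0`.
      have h1 := commute_of_mem_realEnvelope hA hu hk.1
      have h2 := commute_of_mem_realEnvelope hA hIu hk.1
      have h3 : (Complex.I • u).restrictScalars ℝ = mulI H * u.restrictScalars ℝ := rfl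
      rw [h3, mul_assoc, ← mul_assoc k, ← neg_neg (k * mulI H), ← hk.2, neg_mul, mul_assoc, h1,
        eq_neg_iff_add_eq_zero, ← two_smul ℝ, smul_eq_zero] at h2
      have h4 := h2.resolve_left two_ne_zero
      have h5 := congrArg (mulI H * ·) h4
      simp only [← mul_assoc, mulI_mul_mulI, mul_zero] at h5
      rw [h1]
      exact Eq.symm (by simpa using h5)
    · rw [mul_assoc, antiCompl_mul_self]
  have h := key (star y) (star_mem hy) (by
    have : Complex.I • star y = -star (Complex.I • y) := by simp [star_smul]
    rw [this]
    exact neg_mem (star_mem hIy))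
  have := congrArg star h
  rwa [star_mul, ← restrictScalars_star, star_star, star_antiCompl] at this

/-- Every positive element of `W(A)` has a decomposition `x = a + i b`, and `x ≤ 2 a`. -/
theorem exists_isDecomposition {A : Submodule ℝ (H →L[ℂ] H)} (hA : IsJWAlgebra A)
    (hrev : IsReversible A) {e : H →L[ℂ] H} (he : e ∈ A)
    (hunit : ∀ a ∈ A, e * a = a ∧ a * e = a) {x : H →L[ℂ] H} (hxW : x ∈ envelope A)
    (hx0 : 0 ≤ x) : ∃ a : A, ∃ b, IsDecomposition A x a b ∧ x ≤ (2 : ℝ) • (a : H →L[ℂ] H) := by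
  have hS := star_eq_of_mem_realOps hA
  have hSJ := mul_mulI_of_mem_realOps (A := A)
  have hxc : ∀ t : H →L[ℂ] H, (∀ a ∈ A, a * t = t * a) → x * t = t * x :=
    fun t ht => commute_of_mem_envelope hA hxW ht
  have hxc' := commute_linCommutant_of_commute hxc
  have hxe : x * e = x := mul_unit_of_mem_envelope hA he hunit hxW
  obtain ⟨z, hz0, hz⟩ := exists_nonneg_isOpConj hA hx0 hxc
  have hze : z * e = z := by
    have her : e.restrictScalars ℝ ∈ realOps A := ⟨e, he, rfl⟩
    have hxe' : x.restrictScalars ℝ * e.restrictScalars ℝ = x.restrictScalars ℝ :=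
      congrArg (ContinuousLinearMap.restrictScalars ℝ) hxe
    refine restrictScalars_injective (antiCommutant_ext (S := realOps A) (J := mulI H)
      (fun k hk => ?_) ?_)
    · rw [restrictScalars_mul, mul_assoc, hk.1 _ her, ← mul_assoc, hz.mul_anti k hk, mul_assoc,
        hxe']
    · rw [restrictScalars_mul, mul_assoc, antiCompl_comm_of_mem hS her, ← mul_assoc, hz.mul_compl,
        mul_assoc, ← antiCompl_comm_of_mem hS her, ← mul_assoc, hxe']
  have hxs := IsSelfAdjoint.of_nonneg hx0
  have hzs := IsSelfAdjoint.of_nonneg hz0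
  have hlin : ∀ k ∈ linCommutant (realOps A) (mulI H),
      z.restrictScalars ℝ * k = k * z.restrictScalars ℝ := fun k hk =>
    hz.comm_linCommutant hS star_mulI hxc' hk
  have hanti : ∀ k ∈ antiCommutant (realOps A) (mulI H),
      x.restrictScalars ℝ * k = k * z.restrictScalars ℝ := fun k hk =>
    (hz.anti_mul hS star_mulI hSJ hxc' hk).symm
  -- The linear part of a commuting real operator commutes with `x` and `z`; the conjugate linear
  -- part interchanges them and so commutes with the sum.
  have ha : (1 / 2 : ℝ) • (x + z) ∈ A := by
    refine mem_of_bicommutant hA hrev he (fun k hk => ?_) ?_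
      (by rw [IsSelfAdjoint, star_smul, star_add, hxs.star_eq, hzs.star_eq, star_trivial])
    · obtain ⟨p, hp, q, hq, rfl⟩ := exists_lin_add_anti hk
      have : ((1 / 2 : ℝ) • (x + z)).restrictScalars ℝ =
        (1 / 2 : ℝ) • (x.restrictScalars ℝ + z.restrictScalars ℝ) := rfl
      rw [this, smul_mul_assoc, mul_smul_comm, add_mul, mul_add, mul_add, add_mul, mul_add,
        hxc' p hp, hlin p hp, hanti q hq, hz.mul_anti q hq, mul_add]
      congr 1
      abel
    · rw [smul_mul_assoc, add_mul, hxe, hze]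
  refine ⟨⟨_, ha⟩, (1 / 2 : ℝ) • (-Complex.I) • (x - z), ⟨ha, ?_, ?_, ?_, ?_⟩, ?_⟩
  · refine mem_realEnvelope_of_bicommutant he (fun k hk => ?_) ?_
    · obtain ⟨p, hp, q, hq, rfl⟩ := exists_lin_add_anti hk
      have : ((1 / 2 : ℝ) • (-Complex.I) • (x - z)).restrictScalars ℝ =
          -((1 / 2 : ℝ) • (mulI H * (x.restrictScalars ℝ - z.restrictScalars ℝ))) := by
        ext ξ
        simp
      have h1 : mulI H * (x.restrictScalars ℝ - z.restrictScalars ℝ) * p =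
          p * (mulI H * (x.restrictScalars ℝ - z.restrictScalars ℝ)) := by
        rw [mul_assoc, sub_mul, hxc' p hp, hlin p hp, ← mul_sub, ← mul_assoc, hp.2, mul_assoc]
      -- Moving `q` across reverses the sign of `x - z` and that of `i`, so the two signs cancel.
      have h2 : mulI H * (x.restrictScalars ℝ - z.restrictScalars ℝ) * q =
          q * (mulI H * (x.restrictScalars ℝ - z.restrictScalars ℝ)) := by
        rw [mul_assoc, sub_mul, hanti q hq, hz.mul_anti q hq, ← mul_sub, ← mul_assoc, hq.2,
          neg_mul, mul_assoc, ← mul_neg, ← mul_neg, neg_sub]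
      rw [this, neg_mul, mul_neg, smul_mul_assoc, mul_smul_comm, mul_add, add_mul, h1, h2]
    · rw [smul_mul_assoc, smul_mul_assoc, sub_mul, hxe, hze]
  · simp [star_smul, hxs.star_eq, hzs.star_eq]
  -- The range of `y` lies in the complement of `antiSpace`, where `x` and `z` coincide.
  · intro y hy hIy
    have h1 : (x.restrictScalars ℝ - z.restrictScalars ℝ) * y.restrictScalars ℝ = 0 := by
      rw [← antiCompl_mul_of_mem_inter hA hy hIy, ← mul_assoc, sub_mul, hz.mul_compl, sub_self,
        zero_mul]
    have h2 : (x - z) * y = 0 := restrictScalars_injective h1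
    rw [smul_mul_assoc, smul_mul_assoc, h2, smul_zero, smul_zero]
  · rw [smul_comm Complex.I, smul_smul, mul_neg, Complex.I_mul_I, neg_neg, one_smul, ← smul_add,
      add_add_sub_cancel, ← two_smul ℝ x, smul_smul]
    norm_num
  · rw [smul_smul]
    norm_num
    exact hz0

end Decomposition

/-! ### Strong limits, resolvents and spectral cut-offs of positive operators -/

section Operators

theorem nonneg_of_tendsto {α : Type*} {l : Filter α} [l.NeBot] {s : α → H →L[ℂ] H}
    (hs : ∀ i, 0 ≤ s i) {x : H →L[ℂ] H} (h : ∀ ξ, Tendsto (fun i => s i ξ) l (𝓝 (x ξ))) :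
    0 ≤ x := by
  rw [ContinuousLinearMap.nonneg_iff_isPositive, ContinuousLinearMap.isPositive_iff_complex]
  intro ξ
  have h1 : Tendsto (fun i => inner ℂ (s i ξ) ξ) l (𝓝 (inner ℂ (x ξ) ξ)) :=
    (continuous_id.inner continuous_const).continuousAt.tendsto.comp (h ξ)
  have h2 := (Complex.continuous_re.tendsto _).comp h1
  have hp := fun i => (ContinuousLinearMap.isPositive_iff_complex (s i)).1
    ((ContinuousLinearMap.nonneg_iff_isPositive _).1 (hs i)) ξ
  refine ⟨tendsto_nhds_unique ((Complex.continuous_ofReal.tendsto _).comp h2) ?_,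
    ge_of_tendsto' h2 fun i => (hp i).2⟩
  exact h1.congr fun i => ((hp i).1).symm

theorem le_of_tendsto_apply {α : Type*} {l : Filter α} [l.NeBot] {s : α → H →L[ℂ] H}
    {x b : H →L[ℂ] H} (hs : ∀ i, s i ≤ b) (h : ∀ ξ, Tendsto (fun i => s i ξ) l (𝓝 (x ξ))) :
    x ≤ b :=
  sub_nonneg.1 (nonneg_of_tendsto (l := l) (fun i => sub_nonneg.2 (hs i))
    fun ξ => (tendsto_const_nhds (x := b ξ)).sub (h ξ))

theorem ge_of_tendsto_apply {α : Type*} {l : Filter α} [l.NeBot] {s : α → H →L[ℂ] H}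
    {x b : H →L[ℂ] H} (hs : ∀ᶠ i in l, b ≤ s i) (h : ∀ ξ, Tendsto (fun i => s i ξ) l (𝓝 (x ξ))) :
    b ≤ x := by
  classical
  refine sub_nonneg.1 (nonneg_of_tendsto (l := l) (s := fun i => if b ≤ s i then s i - b else 0)
    (fun i => ?_) fun ξ => ?_)
  · split_ifs with hi
    · exact sub_nonneg.2 hi
    · exact le_rfl
  · refine ((h ξ).sub_const (b ξ)).congr' ?_
    filter_upwards [hs] with i hi
    simp [hi]

theorem sq_le_self_of_nonneg_of_le_one {d : H →L[ℂ] H} (h0 : 0 ≤ d) (h1 : d ≤ 1) : d * d ≤ d := by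
  have hd := IsSelfAdjoint.of_nonneg h0
  have h1' := sub_nonneg.2 h1
  have h2 := IsSelfAdjoint.conjugate_nonneg h1' hd
  have h3 := IsSelfAdjoint.conjugate_nonneg h0 (IsSelfAdjoint.of_nonneg h1')
  have h4 := add_nonneg h2 h3
  have : d * (1 - d) * d + (1 - d) * d * (1 - d) = d - d * d := by noncomm_ring
  rw [this] at h4
  exact sub_nonneg.1 h4

/-- A bounded increasing sequence of positive operators converges strongly. -/
theorem exists_tendsto_of_monotone {u : ℕ → H →L[ℂ] H} (hu : Monotone u) (h0 : ∀ n, 0 ≤ u n)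
    (h1 : ∀ n, u n ≤ 1) : ∃ v : H →L[ℂ] H, ∀ ξ, Tendsto (fun n => u n ξ) atTop (𝓝 (v ξ)) := by
  have hre : ∀ {s t : H →L[ℂ] H}, s ≤ t → ∀ ξ, (inner ℂ (s ξ) ξ).re ≤ (inner ℂ (t ξ) ξ).re := by
    intro s t hst ξ
    have := ((ContinuousLinearMap.isPositive_iff_complex _).1
      ((ContinuousLinearMap.le_def _ _).1 hst) ξ).2
    simpa [inner_sub_left] using this
  have hlim : ∀ ξ, ∃ v, Tendsto (fun n => u n ξ) atTop (𝓝 v) := by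
    intro ξ
    let f : ℕ → ℝ := fun n => (inner ℂ (u n ξ) ξ).re
    have hf : Monotone f := fun m n hmn => hre (hu hmn) ξ
    have hfb : BddAbove (Set.range f) := by
      refine ⟨(inner ℂ ((1 : H →L[ℂ] H) ξ) ξ).re, ?_⟩
      rintro _ ⟨n, rfl⟩
      exact hre (h1 n) ξ
    have hfc : CauchySeq f := (tendsto_atTop_ciSup hf hfb).cauchySeq
    -- For `d = u n - u m` between `0` and `1`, the inequality `d² ≤ d` bounds the vector increment
    -- by the increment of the quadratic form.
    have key : ∀ m n, m ≤ n → ‖u n ξ - u m ξ‖ ^ 2 ≤ f n - f m := by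
      intro m n hmn
      have hd0 : 0 ≤ u n - u m := sub_nonneg.2 (hu hmn)
      have hd1 : u n - u m ≤ 1 := (sub_le_self _ (h0 m)).trans (h1 n)
      have h := hre (sq_le_self_of_nonneg_of_le_one hd0 hd1) ξ
      have hs : inner ℂ (((u n - u m) * (u n - u m)) ξ) ξ =
          inner ℂ ((u n - u m) ξ) ((u n - u m) ξ) := by
        conv_lhs => rw [← (IsSelfAdjoint.of_nonneg hd0).star_eq]
        nth_rw 2 [(IsSelfAdjoint.of_nonneg hd0).star_eq]
        rw [mul_apply_eq_comp, ContinuousLinearMap.star_eq_adjoint,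
          ContinuousLinearMap.adjoint_inner_left]
      rw [hs, inner_self_eq_norm_sq_to_K] at h
      have h' : ((‖(u n - u m) ξ‖ : ℂ) ^ 2).re = ‖(u n - u m) ξ‖ ^ 2 := by
        rw [← Complex.ofReal_pow, Complex.ofReal_re]
      have h2 : (inner ℂ ((u n - u m) ξ) ξ).re = f n - f m := by
        simp [f]
      rw [h2] at h
      exact h'.symm.le.trans h
    refine cauchySeq_tendsto_of_complete (Metric.cauchySeq_iff'.2 fun ε hε => ?_)
    obtain ⟨N, hN⟩ := Metric.cauchySeq_iff'.1 hfc (ε ^ 2) (by positivity)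
    refine ⟨N, fun n hn => ?_⟩
    rw [dist_eq_norm]
    refine lt_of_pow_lt_pow_left₀ 2 hε.le ((key N n hn).trans_lt ?_)
    exact (le_abs_self _).trans_lt (hN n hn)
  choose g hg using hlim
  exact ⟨continuousLinearMapOfTendsto u (tendsto_pi_nhds.2 hg), hg⟩

theorem tendsto_apply_of_mem_closure {q : ℕ → H →L[ℂ] H} (hq : ∀ n, ‖q n‖ ≤ 1) {W : Set H}
    (hW : ∀ v ∈ W, Tendsto (fun n => q n v) atTop (𝓝 v)) {v : H} (hv : v ∈ closure W) :
    Tendsto (fun n => q n v) atTop (𝓝 v) := by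
  rw [Metric.tendsto_atTop]
  intro ε hε
  obtain ⟨w, hw, hvw⟩ := Metric.mem_closure_iff.1 hv (ε / 3) (by positivity)
  obtain ⟨N, hN⟩ := Metric.tendsto_atTop.1 (hW w hw) (ε / 3) (by positivity)
  refine ⟨N, fun n hn => ?_⟩
  have h1 : dist (q n v) (q n w) ≤ dist v w := by
    rw [dist_eq_norm, dist_eq_norm, ← map_sub]
    exact (q n).le_of_opNorm_le (hq n) _ |>.trans_eq (one_mul _)
  have := dist_triangle4 (q n v) (q n w) w v
  have h2 := hN n hn
  rw [dist_comm w v] at this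
  linarith

/-- The bounded transform `c (c + ε)⁻¹` of a positive operator. -/
def boundedTransform (ε : ℝ) (c : H →L[ℂ] H) : H →L[ℂ] H :=
  cfcₙ (fun t : ℝ => t / (|t| + ε)) c

/-- The absolute value in the denominator gives continuity on all of `ℝ`; on the quasispectrum of a
positive operator it changes nothing. -/
theorem continuous_div_abs_add {ε : ℝ} (hε : 0 < ε) : Continuous fun t : ℝ => t / (|t| + ε) :=
  continuous_id.div (continuous_abs.add continuous_const) fun t => by positivity

theorem boundedTransform_mul {ε : ℝ} (hε : 0 < ε) {c : H →L[ℂ] H} (hc : 0 ≤ c) :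
    boundedTransform ε c * c = c - ε • boundedTransform ε c := by
  have hcont := (continuous_div_abs_add hε).continuousOn (s := quasispectrum ℝ c)
  have hcs := IsSelfAdjoint.of_nonneg hc
  have h1 : boundedTransform ε c * c = cfcₙ (fun t : ℝ => t / (|t| + ε) * t) c := by
    rw [cfcₙ_mul (fun t : ℝ => t / (|t| + ε)) (fun t => t) c hcont (by simp) (by fun_prop) rfl,
      cfcₙ_id' ℝ c]
    rfl
  have h2 : c - ε • boundedTransform ε c = cfcₙ (fun t : ℝ => t - ε • (t / (|t| + ε))) c := by
    rw [cfcₙ_sub (fun t : ℝ => t) (fun t => ε • (t / (|t| + ε))) c (by fun_prop) rfl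
      (hcont.const_smul ε) (by simp), cfcₙ_smul ε _ c hcont (by simp), cfcₙ_id' ℝ c]
    rfl
  rw [h1, h2]
  refine cfcₙ_congr fun t ht => ?_
  have ht0 : 0 ≤ t := quasispectrum_nonneg_of_nonneg c hc t ht
  have : t + ε ≠ 0 := by positivity
  simp only [abs_of_nonneg ht0, smul_eq_mul]
  field_simp
  ring

theorem boundedTransform_nonneg {ε : ℝ} (hε : 0 < ε) {c : H →L[ℂ] H} (hc : 0 ≤ c) :
    0 ≤ boundedTransform ε c := by
  refine cfcₙ_nonneg fun t ht => ?_
  have ht0 : 0 ≤ t := quasispectrum_nonneg_of_nonneg c hc t ht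
  positivity

theorem norm_boundedTransform_le {ε : ℝ} (hε : 0 < ε) (c : H →L[ℂ] H) :
    ‖boundedTransform ε c‖ ≤ 1 := by
  refine norm_cfcₙ_le fun t _ => ?_
  rw [Real.norm_eq_abs, abs_div, abs_of_nonneg (by positivity : 0 ≤ |t| + ε)]
  exact div_le_one_of_le₀ (by linarith) (by positivity)

theorem boundedTransform_le_one {ε : ℝ} (hε : 0 < ε) {c : H →L[ℂ] H} (hc : 0 ≤ c) :
    boundedTransform ε c ≤ 1 :=
  (CStarAlgebra.norm_le_one_iff_of_nonneg _ (boundedTransform_nonneg hε hc)).1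
    (norm_boundedTransform_le hε c)

/-- The projection onto the closure of the range. -/
def rangeProj (c : H →L[ℂ] H) : H →L[ℂ] H :=
  have : CompleteSpace (LinearMap.range c.toLinearMap).topologicalClosure :=
    (Submodule.isClosed_topologicalClosure _).completeSpace_coe
  (LinearMap.range c.toLinearMap).topologicalClosure.starProjection

theorem isStarProjection_rangeProj (c : H →L[ℂ] H) : IsStarProjection (rangeProj c) := by
  have : CompleteSpace (LinearMap.range c.toLinearMap).topologicalClosure :=
    (Submodule.isClosed_topologicalClosure _).completeSpace_coe
  exact isStarProjection_starProjection
    (U := (LinearMap.range c.toLinearMap).topologicalClosure)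

theorem rangeProj_apply_mem (c : H →L[ℂ] H) (ξ : H) : rangeProj c ξ ∈ closure (Set.range c) := by
  have : CompleteSpace (LinearMap.range c.toLinearMap).topologicalClosure :=
    (Submodule.isClosed_topologicalClosure _).completeSpace_coe
  exact Submodule.starProjection_apply_mem
    (LinearMap.range c.toLinearMap).topologicalClosure ξ

theorem rangeProj_mul (c : H →L[ℂ] H) : rangeProj c * c = c := by
  have : CompleteSpace (LinearMap.range c.toLinearMap).topologicalClosure :=
    (Submodule.isClosed_topologicalClosure _).completeSpace_coe
  ext ξ
  exact Submodule.starProjection_eq_self_iff.2 (Submodule.le_topologicalClosure _ ⟨ξ, rfl⟩)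

/-- On a vector `c η` the error is `ε` times the transform of `η`, hence at most `ε ‖η‖`; density
extends this to the closed range. On its orthogonal complement `c` vanishes, and so does the
transform. -/
theorem tendsto_boundedTransform {c : H →L[ℂ] H} (hc : 0 ≤ c) (ξ : H) :
    Tendsto (fun n : ℕ => boundedTransform (1 / ((n : ℝ) + 1)) c ξ) atTop (𝓝 (rangeProj c ξ)) := by
  have hε : ∀ n : ℕ, (0 : ℝ) < 1 / ((n : ℝ) + 1) := fun n => by positivity
  have hsplit : ∀ n : ℕ, boundedTransform (1 / ((n : ℝ) + 1)) c ξ =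
      boundedTransform (1 / ((n : ℝ) + 1)) c (rangeProj c ξ) := by
    intro n
    have h0 : c (ξ - rangeProj c ξ) = 0 := by
      have := congrArg star (rangeProj_mul c)
      rw [star_mul, (isStarProjection_rangeProj c).isSelfAdjoint.star_eq,
        (IsSelfAdjoint.of_nonneg hc).star_eq] at this
      rw [map_sub, sub_eq_zero]
      exact (congrArg (fun r => r ξ) this).symm
    have h1 := congrArg (fun r => r (ξ - rangeProj c ξ)) (boundedTransform_mul (hε n) hc)
    simp only [mul_apply_eq_comp, sub_apply, h0, map_zero, zero_sub] at h1
    have h2 : (1 / ((n : ℝ) + 1)) • boundedTransform (1 / ((n : ℝ) + 1)) c (ξ - rangeProj c ξ) = 0 :=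
      neg_eq_zero.1 h1.symm
    rw [smul_eq_zero, map_sub, sub_eq_zero] at h2
    exact h2.resolve_left (hε n).ne'
  simp only [hsplit]
  refine tendsto_apply_of_mem_closure (fun n => norm_boundedTransform_le (hε n) c) ?_
    (rangeProj_apply_mem c ξ)
  rintro _ ⟨η, rfl⟩
  rw [tendsto_iff_norm_sub_tendsto_zero]
  refine squeeze_zero (g := fun n : ℕ => 1 / ((n : ℝ) + 1) * ‖η‖) (fun _ => norm_nonneg _)
    (fun n => ?_) (by simpa using tendsto_one_div_add_atTop_nhds_zero_nat.mul_const ‖η‖)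
  have h1 := congrArg (fun r => r η) (boundedTransform_mul (hε n) hc)
  have h2 : boundedTransform (1 / ((n : ℝ) + 1)) c (c η) - c η =
      -((1 / ((n : ℝ) + 1)) • boundedTransform (1 / ((n : ℝ) + 1)) c η) := by
    rw [sub_eq_iff_eq_add, neg_add_eq_sub]
    exact h1
  rw [h2, norm_neg, norm_smul, Real.norm_of_nonneg (hε n).le]
  exact mul_le_mul_of_nonneg_left (((boundedTransform _ c).le_of_opNorm_le
    (norm_boundedTransform_le (hε n) c) η).trans_eq (one_mul _)) (hε n).le

/-- If `X = R⁻¹` and `0 ≤ T ≤ X`, then `T R T ≤ T`. -/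
theorem mul_mul_self_le_of_le_inv {T X R : H →L[ℂ] H} (hT : 0 ≤ T) (hTX : T ≤ X) (hXR : X * R = 1)
    (hR : IsSelfAdjoint R) : T * R * T ≤ T := by
  have hTs := (IsSelfAdjoint.of_nonneg hT).star_eq
  have h1 : 0 ≤ (T * R - 1) * T * (R * T - 1) := by
    have := star_left_conjugate_nonneg hT (R * T - 1)
    rwa [star_sub, star_mul, hTs, hR.star_eq, star_one] at this
  have h2 : 0 ≤ T * R * (X - T) * (R * T) := by
    have := star_left_conjugate_nonneg (sub_nonneg.2 hTX) (R * T)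
    rwa [star_mul, hTs, hR.star_eq] at this
  have h3 : T * R * (X - T) * (R * T) = T * R * T - T * R * T * (R * T) := by
    rw [mul_sub, sub_mul, mul_assoc (T * R) X, ← mul_assoc X, hXR, one_mul]
  have h4 := add_nonneg h1 h2
  rw [h3] at h4
  have h5 : (T * R - 1) * T * (R * T - 1) + (T * R * T - T * R * T * (R * T)) = T - T * R * T := by
    noncomm_ring
  rw [h5] at h4
  exact sub_nonneg.1 h4

/-- Inversion is operator antitone. -/
theorem inv_le_inv_of_le {X₁ X₂ R₁ R₂ : H →L[ℂ] H} (h₁ : X₁ * R₁ = 1) (h₁' : R₁ * X₁ = 1)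
    (h₂' : R₂ * X₂ = 1) (hX₁ : IsSelfAdjoint X₁) (hX₂ : IsSelfAdjoint X₂)
    (hR : 0 ≤ R₁) (h : R₁ ≤ R₂) : X₂ ≤ X₁ := by
  have h3 := IsSelfAdjoint.conjugate_nonneg hR (hX₁.sub hX₂)
  have h4 := IsSelfAdjoint.conjugate_nonneg (sub_nonneg.2 h) hX₂
  have h5 : (X₁ - X₂) * R₁ * (X₁ - X₂) + X₂ * (R₂ - R₁) * X₂ = X₁ - X₂ := by
    have e1 : (X₁ - X₂) * R₁ * (X₁ - X₂) = X₁ - X₂ - X₂ + X₂ * R₁ * X₂ := by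
      rw [sub_mul, h₁, sub_mul, one_mul, mul_sub, mul_assoc X₂ R₁ X₁, h₁', mul_one]
      abel
    have e2 : X₂ * (R₂ - R₁) * X₂ = X₂ - X₂ * R₁ * X₂ := by
      rw [mul_sub, sub_mul, mul_assoc X₂ R₂, h₂', mul_one]
    rw [e1, e2]
    abel
  have := add_nonneg h3 h4
  rw [h5] at this
  exact sub_nonneg.1 this

/-- The cut-off `(T - δ)₊`. -/
def cutoff (δ : ℝ) (T : H →L[ℂ] H) : H →L[ℂ] H := cfcₙ (fun t : ℝ => max (t - δ) 0) T

theorem cutoff_nonneg (δ : ℝ) (T : H →L[ℂ] H) : 0 ≤ cutoff δ T :=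
  cfcₙ_nonneg fun _ _ => le_max_right _ _

theorem norm_sub_cutoff_le {δ : ℝ} (hδ : 0 < δ) {T : H →L[ℂ] H} (hT : 0 ≤ T) :
    ‖T - cutoff δ T‖ ≤ δ := by
  have hTs := IsSelfAdjoint.of_nonneg hT
  have : T - cutoff δ T = cfcₙ (fun t : ℝ => t - max (t - δ) 0) T := by
    rw [cfcₙ_sub (fun t : ℝ => t) (fun t => max (t - δ) 0) T (by fun_prop) rfl (by fun_prop)
      (by simp [hδ.le]), cfcₙ_id' ℝ T]
    rfl
  rw [this]
  refine norm_cfcₙ_le fun t ht => ?_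
  have ht0 : 0 ≤ t := quasispectrum_nonneg_of_nonneg T hT t ht
  rw [Real.norm_eq_abs, abs_le]
  rcases max_cases (t - δ) 0 with h | h <;> constructor <;> linarith

theorem cutoff_mul_mul_cutoff_le {δ : ℝ} (hδ : 0 < δ) {T R : H →L[ℂ] H} (hT : 0 ≤ T)
    (hTR : T * R * T ≤ T) : cutoff δ T * R * cutoff δ T ≤ δ⁻¹ • (cutoff δ T * cutoff δ T) := by
  have hTs := IsSelfAdjoint.of_nonneg hT
  -- This is `(t - δ)₊ / t` for `t > 0`, with the denominator kept away from `0`. Then `g T = (T -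
  -- δ)₊`, so `T R T ≤ T` can be conjugated by `g`, and `f t ≤ δ⁻¹ (t - δ)₊`.
  let f : ℝ → ℝ := fun t => max (t - δ) 0 / max t δ
  have hpos : ∀ t : ℝ, 0 < max t δ := fun t => lt_max_of_lt_right hδ
  have hf : Continuous f := by
    refine Continuous.div (by fun_prop) (by fun_prop) fun t => (hpos t).ne'
  have hf0 : f 0 = 0 := by simp [f, hδ.le]
  have hft : ∀ t, 0 ≤ t → f t * t = max (t - δ) 0 := by
    intro t ht
    simp only [f]
    rcases le_total t δ with h | h
    · rw [max_eq_right (sub_nonpos.2 h)]; simp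
    · rw [max_eq_left (sub_nonneg.2 h), max_eq_left h, div_mul_cancel₀]
      exact (hδ.trans_le h).ne'
  let g := cfcₙ f T
  have hg : IsSelfAdjoint g := cfcₙ_predicate f T
  have hgT : g * T = cutoff δ T := by
    have : g * T = cfcₙ (fun t => f t * t) T := by
      rw [cfcₙ_mul f (fun t => t) T hf.continuousOn hf0 (by fun_prop) rfl, cfcₙ_id' ℝ T]
    rw [this]
    exact cfcₙ_congr fun t ht => hft t (quasispectrum_nonneg_of_nonneg T hT t ht)
  have hTg : T * g = cutoff δ T := by
    have := congrArg star hgT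
    rwa [star_mul, hg.star_eq, hTs.star_eq,
      (IsSelfAdjoint.of_nonneg (cutoff_nonneg δ T)).star_eq] at this
  have h1 : cutoff δ T * R * cutoff δ T ≤ g * T * g := by
    have := star_left_conjugate_le_conjugate hTR g
    rw [hg.star_eq] at this
    convert this using 1
    rw [← hTg]
    nth_rw 1 [hTg]
    rw [← hgT]
    noncomm_ring
  refine h1.trans ?_
  rw [hgT]
  have hm : Continuous fun t : ℝ => max (t - δ) 0 := by fun_prop
  have hm0 : max ((0 : ℝ) - δ) 0 = 0 := by simp [hδ.le]
  have h2 : cutoff δ T * g = cfcₙ (fun t => max (t - δ) 0 * f t) T := by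
    rw [cfcₙ_mul (fun t => max (t - δ) 0) f T hm.continuousOn hm0 hf.continuousOn hf0]
    rfl
  have h3 : δ⁻¹ • (cutoff δ T * cutoff δ T) =
      cfcₙ (fun t : ℝ => δ⁻¹ • (max (t - δ) 0 * max (t - δ) 0)) T := by
    rw [cfcₙ_smul δ⁻¹ (fun t : ℝ => max (t - δ) 0 * max (t - δ) 0) T (hm.mul hm).continuousOn
      (by rw [hm0, zero_mul]),
      cfcₙ_mul _ _ T hm.continuousOn hm0 hm.continuousOn hm0]
    rfl
  rw [h2, h3]
  refine cfcₙ_mono (fun t ht => ?_) (hm.mul hf).continuousOn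
    ((hm.mul hm).const_smul δ⁻¹).continuousOn (by rw [hm0, zero_mul])
    (by rw [hm0, zero_mul, smul_zero])
  have hmt : 0 ≤ max (t - δ) 0 := le_max_right _ _
  have hft' : f t ≤ δ⁻¹ * max (t - δ) 0 := by
    simp only [f]
    rw [div_eq_mul_inv, mul_comm]
    exact mul_le_mul_of_nonneg_right ((inv_le_inv₀ (hpos t) hδ).2 (le_max_right _ _)) hmt
  calc max (t - δ) 0 * f t ≤ max (t - δ) 0 * (δ⁻¹ * max (t - δ) 0) :=
        mul_le_mul_of_nonneg_left hft' hmt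
    _ = δ⁻¹ • (max (t - δ) 0 * max (t - δ) 0) := by rw [smul_eq_mul]; ring

/-- The hypothesis says that the quadratic form of `Y` is nonnegative on the range of `c`; by
continuity it is so on the closure. -/
theorem rangeProj_mul_mul_rangeProj_nonneg {c Y : H →L[ℂ] H} (hc : 0 ≤ c)
    (h : 0 ≤ c * Y * c) (hY : IsSelfAdjoint Y) : 0 ≤ rangeProj c * Y * rangeProj c := by
  have hps := (isStarProjection_rangeProj c).isSelfAdjoint
  rw [ContinuousLinearMap.nonneg_iff_isPositive]
  refine ContinuousLinearMap.isPositive_def'.2 ⟨?_, fun ξ => ?_⟩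
  · rw [IsSelfAdjoint, star_mul, star_mul,
      hps.star_eq, hY.star_eq, mul_assoc]
  have hmove : ∀ (s : H →L[ℂ] H), IsSelfAdjoint s → ∀ η,
      inner ℂ ((s * Y * s) η) η = inner ℂ (Y (s η)) (s η) := by
    intro s hs η
    have : (s * Y * s) η = star s (Y (s η)) := by rw [hs.star_eq]; rfl
    rw [this, ContinuousLinearMap.star_eq_adjoint, ContinuousLinearMap.adjoint_inner_left]
  have hcl : IsClosed {v : H | 0 ≤ (inner ℂ (Y v) v).re} :=
    isClosed_le continuous_const (Complex.continuous_re.comp (Y.continuous.inner continuous_id))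
  rw [ContinuousLinearMap.reApplyInnerSelf_apply, hmove _ hps]
  refine closure_minimal ?_ hcl (rangeProj_apply_mem c ξ)
  rintro _ ⟨η, rfl⟩
  have := ((ContinuousLinearMap.isPositive_iff_complex _).1
    ((ContinuousLinearMap.nonneg_iff_isPositive _).1 h) η).2
  rw [hmove _ (IsSelfAdjoint.of_nonneg hc)] at this
  exact this

end Operators

/-! ### Projections of `A` with uniformly bounded compressions -/

section JW

variable {A : Submodule ℝ (H →L[ℂ] H)}

theorem IsWOTClosed.isClosed {S : Set (H →L[ℂ] H)} (hS : IsWOTClosed S) : IsClosed S :=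
  IsClosed.preimage (ContinuousLinearMapWOT.continuous_ofCLM (σ := RingHom.id ℂ) (E := H) (F := H))
    hS

/-- Jordan powers are ordinary powers, so `A` contains the norm-closed algebra without unit
generated by `a`. The calculus without unit is needed because `1` may lie outside `A`. -/
theorem IsJWAlgebra.cfcₙ_mem (hA : IsJWAlgebra A) {a : H →L[ℂ] H} (ha : a ∈ A) (f : ℝ → ℝ) :
    cfcₙ f a ∈ A := by
  have hpow : ∀ n : ℕ, a ^ (n + 1) ∈ A := by
    intro n
    induction n with
    | zero => simpa using ha
    | succ n ih =>
      have := hA.jordan_mem _ ih _ ha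
      rwa [← pow_succ, ← pow_succ', ← two_smul ℝ (a ^ (n + 1 + 1)), smul_smul, one_div,
        inv_mul_cancel₀ two_ne_zero, one_smul] at this
  have hadj : ((NonUnitalStarAlgebra.adjoin ℝ {a} : NonUnitalStarSubalgebra ℝ (H →L[ℂ] H)) :
      Set (H →L[ℂ] H)) ⊆ A := by
    intro x hx
    have h1 := NonUnitalStarAlgebra.adjoin_eq_span (R := ℝ) ({a} : Set (H →L[ℂ] H))
    have h2 : ({a} : Set (H →L[ℂ] H)) ∪ star {a} = {a} := by
      rw [Set.star_singleton, (hA.selfAdjoint a ha).star_eq, Set.union_self]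
    rw [h2] at h1
    have h3 : x ∈ Submodule.span ℝ (Subsemigroup.closure ({a} : Set (H →L[ℂ] H)) :
        Set (H →L[ℂ] H)) := by
      rw [← h1]
      exact hx
    refine Submodule.span_le.2 ?_ h3
    intro y hy
    have : ∃ n : ℕ, y = a ^ (n + 1) := by
      induction hy using Subsemigroup.closure_induction with
      | mem b hb => exact ⟨0, by simpa using hb⟩
      | mul b c _ _ hb hc =>
        obtain ⟨m, rfl⟩ := hb
        obtain ⟨n, rfl⟩ := hc
        exact ⟨m + 1 + n, by rw [← pow_add]; congr 1⟩
    obtain ⟨n, rfl⟩ := this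
    exact hpow n
  exact closure_minimal hadj hA.closed.isClosed (cfcₙ_mem_elemental f a)

theorem IsReversible.mul_mul_mem (hrev : IsReversible A) {a p : H →L[ℂ] H} (ha : a ∈ A)
    (hp : p ∈ A) : p * a * p ∈ A := by
  have := hrev [p, a, p] (by simp) (by simp [ha, hp])
  have h2 : [p, a, p].prod + [p, a, p].reverse.prod = (2 : ℝ) • (p * a * p) := by
    simp [two_smul, mul_assoc]
  rw [h2] at this
  have h3 := A.smul_mem (2⁻¹ : ℝ) this
  rwa [smul_smul, inv_mul_cancel₀ two_ne_zero, one_smul] at h3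

theorem IsJWAlgebra.rangeProj_mem (hA : IsJWAlgebra A) {c : H →L[ℂ] H} (hc : c ∈ A)
    (hc0 : 0 ≤ c) : rangeProj c ∈ A :=
  hA.closed.mem_of_tendsto (l := atTop)
    (s := fun n : ℕ => boundedTransform (1 / ((n : ℝ) + 1)) c)
    (fun _ => hA.cfcₙ_mem hc _) (tendsto_boundedTransform hc0)

/-- Along an increasing sequence `S n` in `A⁺` with bounded values of a faithful normal state,
there are projections of `A` compressing all `S n` to a bounded sequence and tending strongly to
the unit. -/
theorem exists_projections_of_bounded (hA : IsJWAlgebra A) (hrev : IsReversible A)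
    {ρ : A →ₗ[ℝ] ℝ} (hρ : IsFaithfulNormalState A ρ) {e : A}
    (hunit : ∀ a ∈ A, (e : H →L[ℂ] H) * a = a ∧ a * (e : H →L[ℂ] H) = a)
    {S : ℕ → A} (hS0 : ∀ n, 0 ≤ (S n : H →L[ℂ] H)) (hSm : Monotone S) {C : ℝ}
    (hC : ∀ n, ρ (S n) ≤ C) :
    ∃ p : ℕ → H →L[ℂ] H, (∀ j, p j ∈ A) ∧ (∀ j, IsStarProjection (p j)) ∧
      (∀ j, ∃ K, ∀ n, ‖p j * S n * p j‖ ≤ K) ∧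
      ∀ ξ, Tendsto (fun j => p j ξ) atTop (𝓝 ((e : H →L[ℂ] H) ξ)) := by
  have hes : IsSelfAdjoint (e : H →L[ℂ] H) := hA.selfAdjoint _ e.2
  have hee : (e : H →L[ℂ] H) * e = e := (hunit e e.2).1
  -- Here `U n = S n (1 + S n)⁻¹` lies in `A`, and `X n = 1 - U n` is the inverse of `R n = 1 + S
  -- n`.
  let U : ℕ → H →L[ℂ] H := fun n => boundedTransform 1 (S n)
  let R : ℕ → H →L[ℂ] H := fun n => 1 + S n
  let X : ℕ → H →L[ℂ] H := fun n => 1 - U n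
  have hUA : ∀ n, U n ∈ A := fun n => hA.cfcₙ_mem (S n).2 _
  have hU0 : ∀ n, 0 ≤ U n := fun n => boundedTransform_nonneg one_pos (hS0 n)
  have hU1 : ∀ n, U n ≤ 1 := fun n => boundedTransform_le_one one_pos (hS0 n)
  have hX0 : ∀ n, 0 ≤ X n := fun n => sub_nonneg.2 (hU1 n)
  have hXs : ∀ n, IsSelfAdjoint (X n) := fun n => IsSelfAdjoint.of_nonneg (hX0 n)
  have hR0 : ∀ n, 0 ≤ R n := fun n => add_nonneg zero_le_one (hS0 n)
  have hRs : ∀ n, IsSelfAdjoint (R n) := fun n => IsSelfAdjoint.of_nonneg (hR0 n)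
  have hXR : ∀ n, X n * R n = 1 := by
    intro n
    have := boundedTransform_mul one_pos (hS0 n)
    rw [one_smul] at this
    simp only [X, R, U]
    rw [mul_add, mul_one, sub_mul, one_mul, this]
    abel
  have hRX : ∀ n, R n * X n = 1 := by
    intro n
    have := congrArg star (hXR n)
    rwa [star_mul, (hXs n).star_eq, (hRs n).star_eq, star_one] at this
  have hUm : Monotone U := by
    intro m n hmn
    have hRm : R m ≤ R n := add_le_add_right (show (S m : H →L[ℂ] H) ≤ S n from hSm hmn) 1
    have := inv_le_inv_of_le (hXR m) (hRX m) (hRX n) (hXs m) (hXs n) (hR0 m) hRm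
    exact (sub_le_sub_iff_left 1).1 this
  obtain ⟨V, hV⟩ := exists_tendsto_of_monotone hUm hU0 hU1
  have hVA : V ∈ A := hA.closed.mem_of_tendsto (l := atTop) hUA hV
  have hUV : ∀ n, U n ≤ V := fun n =>
    ge_of_tendsto_apply ((eventually_ge_atTop n).mono fun m hm => hUm hm) hV
  have hUe : ∀ n, U n ≤ e := by
    intro n
    have := IsSelfAdjoint.conjugate_nonneg (hX0 n) hes
    have h2 : (e : H →L[ℂ] H) * X n * e = e - U n := by
      simp only [X]
      rw [mul_sub, mul_one, (hunit _ (hUA n)).1, sub_mul, hee, (hunit _ (hUA n)).2]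
    rw [h2] at this
    exact sub_nonneg.1 this
  let T : H →L[ℂ] H := e - V
  have hTA : T ∈ A := sub_mem e.2 hVA
  have hT0 : 0 ≤ T := sub_nonneg.2 (le_of_tendsto_apply hUe hV)
  have he1 : (e : H →L[ℂ] H) ≤ 1 := IsStarProjection.le_one ⟨hee, hes⟩
  have hTX : ∀ n, T ≤ X n := fun n => sub_le_sub he1 (hUV n)
  have hTRT : ∀ n, T * R n * T ≤ T := fun n =>
    mul_mul_self_le_of_le_inv hT0 (hTX n) (hXR n) (hRs n)
  -- the kernel of `T` in `e`
  have hsA : rangeProj T ∈ A := hA.rangeProj_mem hTA hT0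
  have hsp := isStarProjection_rangeProj T
  let q : A := e - ⟨rangeProj T, hsA⟩
  have hq : (q : H →L[ℂ] H) = e - rangeProj T := rfl
  have hqs : IsSelfAdjoint (q : H →L[ℂ] H) := hA.selfAdjoint _ q.2
  have hqq : (q : H →L[ℂ] H) * q = q := by
    rw [hq, mul_sub, sub_mul, sub_mul, hee, (hunit _ hsA).1, (hunit _ hsA).2,
      hsp.isIdempotentElem.eq]
    abel
  have hqp : IsStarProjection (q : H →L[ℂ] H) := ⟨hqq, hqs⟩
  have hqT : (q : H →L[ℂ] H) * T = 0 := by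
    rw [hq, sub_mul, (hunit _ hTA).1, rangeProj_mul, sub_self]
  have hqV : (q : H →L[ℂ] H) * V * q = q := by
    have : V = e - T := by simp [T]
    rw [this, mul_sub, hqT, sub_zero, (hunit _ q.2).2, hqq]
  let Q : ℕ → A := fun n => ⟨q * U n * q, hrev.mul_mul_mem (hUA n) q.2⟩
  have hQm : Monotone Q := fun m n hmn => by
    have := star_left_conjugate_le_conjugate (hUm hmn) (q : H →L[ℂ] H)
    rw [hqs.star_eq] at this
    exact this
  have hQlub : IsLUB (Set.range Q) q := by
    constructor
    · rintro _ ⟨n, rfl⟩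
      have := star_left_conjugate_le_conjugate (hU1 n) (q : H →L[ℂ] H)
      rw [hqs.star_eq, mul_one, hqq] at this
      exact this
    · intro b hb
      have : (q : H →L[ℂ] H) * V * q ≤ b := by
        refine le_of_tendsto_apply (l := atTop) (s := fun n => (Q n : H →L[ℂ] H))
          (fun n => hb ⟨n, rfl⟩) fun ξ => ?_
        exact ((q : H →L[ℂ] H).continuous.tendsto _).comp (hV _)
      rw [hqV] at this
      exact this
  have hρlub := hρ.normal (Set.range Q) q (Set.range_nonempty Q)
    (directedOn_range.2 hQm.directed_le) hQlub
  have hρe : ρ e = 1 := by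
    obtain ⟨e', he', he1'⟩ := hρ.unit
    have : e = e' := Subtype.ext (by rw [← (he' e e.2).1, (hunit e' e'.2).2])
    rw [this, he1']
  -- A Cauchy-Schwarz argument: expand `(t q + R n) X n (t q + R n) ≥ 0` using `X n R n = 1`, then
  -- compress by `e`, since `1` may lie outside `A`, and apply `ρ`.
  have hineq : ∀ (t : ℝ) n, 0 ≤ t ^ 2 * (ρ q - ρ (Q n)) + 2 * t * ρ q + (1 + ρ (S n)) := by
    intro t n
    have h1 : 0 ≤ (t • (q : H →L[ℂ] H) + R n) * X n * (t • (q : H →L[ℂ] H) + R n) :=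
      IsSelfAdjoint.conjugate_nonneg (hX0 n) (IsSelfAdjoint.add
        (by rw [IsSelfAdjoint, star_smul, hqs.star_eq, star_trivial]) (hRs n))
    have h2 := IsSelfAdjoint.conjugate_nonneg h1 hes
    have h3 : (e : H →L[ℂ] H) * ((t • (q : H →L[ℂ] H) + R n) * X n *
        (t • (q : H →L[ℂ] H) + R n)) * e =
        ((t ^ 2 • (q - Q n) + (2 * t) • q + (e + S n) : A) : H →L[ℂ] H) := by
      have e1 : (t • (q : H →L[ℂ] H) + R n) * X n * (t • (q : H →L[ℂ] H) + R n) =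
          t ^ 2 • ((q : H →L[ℂ] H) - q * U n * q) + (2 * t) • (q : H →L[ℂ] H) + R n := by
        have e2 : (q : H →L[ℂ] H) * X n * q = q - q * U n * q := by
          simp only [X]
          rw [mul_sub, mul_one, sub_mul, hqq]
        rw [add_mul, hRX, add_mul, one_mul, mul_add, mul_assoc _ (X n) (R n), hXR, mul_one,
          smul_mul_assoc, smul_mul_assoc, mul_smul_comm, e2, smul_smul, ← pow_two, two_mul,
          add_smul]
        abel
      rw [e1]
      have e3 : (e : H →L[ℂ] H) * (q * U n * q) * e = q * U n * q := by
        rw [(hunit _ (Q n).2).1, (hunit _ (Q n).2).2]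
      have e4 : (e : H →L[ℂ] H) * q * e = q := by rw [(hunit _ q.2).1, (hunit _ q.2).2]
      have e5 : (e : H →L[ℂ] H) * R n * e = e + S n := by
        simp only [R]
        rw [mul_add, mul_one, add_mul, hee, (hunit _ (S n).2).1, (hunit _ (S n).2).2]
      rw [mul_add, mul_add, add_mul, add_mul, e5, mul_smul_comm, mul_smul_comm, smul_mul_assoc,
        smul_mul_assoc, e4, mul_sub, sub_mul, e3, e4]
      rfl
    rw [h3] at h2
    have := hρ.nonneg _ h2
    simpa [hρe] using this
  have hρq : ρ q = 0 := by
    by_contra hne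
    have hpos : 0 < ρ q := lt_of_le_of_ne (hρ.nonneg q hqp.nonneg) (Ne.symm hne)
    have hC0 : 0 < 1 + C := by
      have := hρ.nonneg (S 0) (hS0 0)
      linarith [hC 0]
    -- With this `t` the middle term is `-2 (1 + C)`. By normality `ρ (Q n)` approaches `ρ q`, so
    -- the first term falls below `1 + C` for some `n`, and the last is at most `1 + C`: a
    -- contradiction.
    set t : ℝ := -(1 + C) / ρ q with ht
    have htr : t * ρ q = -(1 + C) := div_mul_cancel₀ _ hpos.ne'
    have ht2 : 0 < t ^ 2 := by
      have : t ≠ 0 := div_ne_zero (neg_ne_zero.2 hC0.ne') hpos.ne'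
      positivity
    obtain ⟨_, ⟨_, ⟨n, rfl⟩, rfl⟩, hn, _⟩ := hρlub.exists_between
      (show ρ q - (1 + C) / t ^ 2 < ρ q from sub_lt_self _ (div_pos hC0 ht2))
    have h1 := hineq t n
    have h2 : t ^ 2 * (ρ q - ρ (Q n)) < 1 + C := by
      have : ρ q - ρ (Q n) < (1 + C) / t ^ 2 := by linarith
      calc t ^ 2 * (ρ q - ρ (Q n)) < t ^ 2 * ((1 + C) / t ^ 2) :=
            mul_lt_mul_of_pos_left this ht2
        _ = 1 + C := mul_div_cancel₀ _ ht2.ne'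
    have h3 := hC n
    nlinarith
  have hse : rangeProj T = e := by
    have := congrArg (Subtype.val) (hρ.faithful q hqp.nonneg hρq)
    exact (sub_eq_zero.1 (hq ▸ this)).symm
  -- the spectral projections of `T`
  have hδ : ∀ j : ℕ, (0 : ℝ) < 1 / ((j : ℝ) + 1) := fun j => by positivity
  let c : ℕ → H →L[ℂ] H := fun j => cutoff (1 / ((j : ℝ) + 1)) T
  have hc0 : ∀ j, 0 ≤ c j := fun j => cutoff_nonneg _ T
  refine ⟨fun j => rangeProj (c j), fun j => hA.rangeProj_mem (hA.cfcₙ_mem hTA _) (hc0 j),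
    fun j => isStarProjection_rangeProj _, fun j => ⟨(1 / ((j : ℝ) + 1))⁻¹, fun n => ?_⟩,
    fun ξ => ?_⟩
  · set δ : ℝ := 1 / ((j : ℝ) + 1) with hδdef
    have hp := isStarProjection_rangeProj (c j)
    have hps := hp.isSelfAdjoint
    have h1 := cutoff_mul_mul_cutoff_le (hδ j) hT0 (hTRT n)
    have h2 : 0 ≤ c j * (δ⁻¹ • (1 : H →L[ℂ] H) - R n) * c j := by
      rw [mul_sub, sub_mul, mul_smul_comm, mul_one, smul_mul_assoc]
      exact sub_nonneg.2 h1
    have h3 := rangeProj_mul_mul_rangeProj_nonneg (hc0 j) h2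
      (IsSelfAdjoint.sub (by rw [IsSelfAdjoint, star_smul, star_one, star_trivial]) (hRs n))
    rw [mul_sub, sub_mul, mul_smul_comm, mul_one, smul_mul_assoc, hp.isIdempotentElem.eq,
      sub_nonneg] at h3
    have h4 : rangeProj (c j) * S n * rangeProj (c j) ≤
        rangeProj (c j) * R n * rangeProj (c j) := by
      have := star_left_conjugate_le_conjugate
        (show (S n : H →L[ℂ] H) ≤ R n from le_add_of_nonneg_left zero_le_one) (rangeProj (c j))
      rwa [hps.star_eq] at this
    refine (CStarAlgebra.norm_le_norm_of_nonneg_of_le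
      (IsSelfAdjoint.conjugate_nonneg (hS0 n) hps) (h4.trans h3)).trans ?_
    rw [norm_smul, Real.norm_of_nonneg (inv_nonneg.2 (hδ j).le)]
    exact mul_le_of_le_one_right (inv_nonneg.2 (hδ j).le) (IsStarProjection.norm_le _ hp)
  · have hpe : ∀ j, rangeProj (c j) ξ = rangeProj (c j) ((e : H →L[ℂ] H) ξ) := fun j =>
      (congrArg (fun r => r ξ) (hunit _ (hA.rangeProj_mem (hA.cfcₙ_mem hTA _) (hc0 j))).2).symm
    simp only [hpe]
    refine tendsto_apply_of_mem_closure (W := Set.range T)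
      (fun j => IsStarProjection.norm_le _ (isStarProjection_rangeProj _)) ?_
      (hse ▸ rangeProj_apply_mem T ξ)
    rintro _ ⟨η, rfl⟩
    rw [tendsto_iff_norm_sub_tendsto_zero]
    refine squeeze_zero (g := fun j : ℕ => 1 / ((j : ℝ) + 1) * ‖η‖) (fun _ => norm_nonneg _)
      (fun j => ?_) (by simpa using tendsto_one_div_add_atTop_nhds_zero_nat.mul_const ‖η‖)
    -- The range projection fixes `c j η`, so only `T - c j`, of norm at most `1 / (j + 1)`,
    -- contributes.
    have h1 : rangeProj (c j) (T η) - T η =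
        -((1 - rangeProj (c j)) ((T - c j) η)) := by
      have := congrArg (fun r => r η) (rangeProj_mul (c j))
      simp only [mul_apply_eq_comp] at this
      simp only [sub_apply, one_apply_eq_self, map_sub, this]
      abel
    rw [h1, norm_neg]
    have h2 := (1 - rangeProj (c j)).le_of_opNorm_le
      (IsStarProjection.norm_le _ (isStarProjection_rangeProj (c j)).one_sub) ((T - c j) η)
    refine h2.trans ?_
    rw [one_mul]
    exact (T - c j).le_of_opNorm_le (norm_sub_cutoff_le (hδ j) hT0) η

end JW

/-! ### Nontrivial bundles and their comparison -/

section Bundle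

/-- A summable sequence remains summable after multiplication by suitable weights tending to
infinity. -/
theorem exists_weights_of_summable {f : ℕ → ℝ} (hf0 : ∀ n, 0 ≤ f n) (hf : Summable f) :
    ∃ w : ℕ → ℝ, (∀ n, 1 ≤ w n) ∧ Tendsto w atTop atTop ∧ Summable fun n => w n * f n := by
  -- The geometric term keeps the tails `r n` strictly positive, so that they can be divided by.
  let g : ℕ → ℝ := fun n => f n + (1 / 2) ^ n
  have hg0 : ∀ n, 0 < g n := fun n => add_pos_of_nonneg_of_pos (hf0 n) (by positivity)
  have hg : Summable g := hf.add summable_geometric_two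
  let r : ℕ → ℝ := fun n => ∑' k, g (k + n)
  have hgn : ∀ n, Summable fun k => g (k + n) := fun n => (summable_nat_add_iff n).2 hg
  have hrsucc : ∀ n, r n = g n + r (n + 1) := by
    intro n
    have := (hgn n).tsum_eq_zero_add
    simp only [zero_add] at this
    simp only [r]
    rw [this]
    congr 2
    ext k
    congr 1
    ring
  have hr0 : ∀ n, 0 < r n := fun n =>
    (hgn n).tsum_pos (fun k => (hg0 _).le) 0 (hg0 _)
  have hr : Tendsto r atTop (𝓝 0) := tendsto_sum_nat_add g
  -- As `g n = r n - r (n + 1)` is a difference of squares of roots and `r` decreases, the quotient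
  -- is dominated by a telescoping term.
  have hstep : ∀ n, g n / √(r n) ≤ 2 * (√(r n) - √(r (n + 1))) := by
    intro n
    have h1 : 0 < √(r n) := Real.sqrt_pos.2 (hr0 n)
    have h2 := Real.sq_sqrt (hr0 n).le
    have h3 := Real.sq_sqrt (hr0 (n + 1)).le
    have h4 := hrsucc n
    rw [div_le_iff₀ h1]
    nlinarith [sq_nonneg (√(r n) - √(r (n + 1)))]
  have hsum : Summable fun n => g n / √(r n) := by
    refine summable_of_sum_range_le (c := 2 * √(r 0))
      (fun n => div_nonneg (hg0 n).le (Real.sqrt_nonneg _)) fun n => ?_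
    refine (Finset.sum_le_sum fun i _ => hstep i).trans ?_
    rw [← Finset.mul_sum, Finset.sum_range_sub']
    have := Real.sqrt_nonneg (r n)
    linarith
  refine ⟨fun n => 1 + (√(r n))⁻¹, fun n => le_add_of_nonneg_right (by positivity), ?_, ?_⟩
  · refine tendsto_atTop_add_const_left _ _ (Tendsto.inv_tendsto_nhdsGT_zero ?_)
    refine tendsto_nhdsWithin_iff.2 ⟨?_, Eventually.of_forall fun n => Real.sqrt_pos.2 (hr0 n)⟩
    simpa [Function.comp_def] using (Real.continuous_sqrt.tendsto 0).comp hr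
  · refine Summable.of_nonneg_of_le (fun n => mul_nonneg (by positivity) (hf0 n)) (fun n => ?_)
      (hf.add hsum)
    have : f n ≤ g n := le_add_of_nonneg_right (by positivity)
    rw [add_mul, one_mul, div_eq_mul_inv, mul_comm (√(r n))⁻¹]
    have h5 : 0 ≤ (√(r n))⁻¹ := by positivity
    gcongr

variable {A : Submodule ℝ (H →L[ℂ] H)}

/-- The bundle of a summable sequence in `A⁺` contains projections tending strongly to the unit,
up to the possible value zero. -/
theorem exists_bundle_tendsto (hA : IsJWAlgebra A) (hrev : IsReversible A)
    {ρ : A →ₗ[ℝ] ℝ} (hρ : IsFaithfulNormalState A ρ) {e : A}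
    (hunit : ∀ a ∈ A, (e : H →L[ℂ] H) * a = a ∧ a * (e : H →L[ℂ] H) = a)
    {D : ℕ → A} (hD0 : ∀ n, 0 ≤ (D n : H →L[ℂ] H)) (hD : Summable fun n => ρ (D n)) :
    ∃ p : ℕ → H →L[ℂ] H,
      (∀ j, p j = 0 ∨ p j ∈ bundle (A : Set (H →L[ℂ] H)) fun m => (D m : H →L[ℂ] H)) ∧
      ∀ ξ, Tendsto (fun j => p j ξ) atTop (𝓝 ((e : H →L[ℂ] H) ξ)) := by
  obtain ⟨w, hw1, hwt, hws⟩ := exists_weights_of_summable (fun n => hρ.nonneg _ (hD0 n)) hD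
  have hw0 : ∀ n, 0 ≤ w n := fun n => zero_le_one.trans (hw1 n)
  let S : ℕ → A := fun n => ∑ k ∈ Finset.range (n + 1), w k • D k
  have hSc : ∀ n, (S n : H →L[ℂ] H) = ∑ k ∈ Finset.range (n + 1), w k • (D k : H →L[ℂ] H) :=
    fun n => by simp [S]
  have hwD : ∀ k, 0 ≤ w k • (D k : H →L[ℂ] H) := fun k => smul_nonneg (hw0 k) (hD0 k)
  have hS0 : ∀ n, 0 ≤ (S n : H →L[ℂ] H) := fun n => by
    rw [hSc]
    exact Finset.sum_nonneg fun k _ => hwD k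
  have hSm : Monotone S := monotone_nat_of_le_succ fun n => by
    change (S n : H →L[ℂ] H) ≤ S (n + 1)
    rw [hSc, hSc, Finset.sum_range_succ _ (n + 1)]
    exact le_add_of_nonneg_right (hwD _)
  obtain ⟨p, hpA, hp, hpK, hpe⟩ := exists_projections_of_bounded hA hrev hρ hunit hS0 hSm
    (C := ∑' n, w n * ρ (D n)) fun n => by
      simp only [S, map_sum, map_smul, smul_eq_mul]
      exact hws.sum_le_tsum _ fun k _ => mul_nonneg (hw0 k) (hρ.nonneg _ (hD0 k))
  refine ⟨p, fun j => or_iff_not_imp_left.2 fun hj => ?_, hpe⟩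
  obtain ⟨K, hK⟩ := hpK j
  have hps := (hp j).isSelfAdjoint
  have hle : ∀ {s t : H →L[ℂ] H}, 0 ≤ s → s ≤ t → ‖p j * s * p j‖ ≤ ‖p j * t * p j‖ := by
    intro s t hs hst
    refine CStarAlgebra.norm_le_norm_of_nonneg_of_le (IsSelfAdjoint.conjugate_nonneg hs hps) ?_
    have := star_left_conjugate_le_conjugate hst (p j)
    rwa [hps.star_eq] at this
  refine ⟨hpA j, hp j, hj, ⟨K, ?_⟩, ?_⟩
  · rintro _ ⟨m, rfl⟩
    refine (hle (Finset.sum_nonneg fun k _ => hD0 k) ?_).trans (hK m)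
    rw [hSc]
    refine Finset.sum_le_sum fun k _ => ?_
    have := smul_nonneg (sub_nonneg.2 (hw1 k)) (hD0 k)
    rwa [sub_smul, one_smul, sub_nonneg] at this
  · refine squeeze_zero (fun _ => norm_nonneg _) (fun m => ?_)
      (by simpa using hwt.inv_tendsto_atTop.mul_const K)
    -- Boundedness of the weighted sums thus gives `‖p D m p‖ ≤ K / w m`, which tends to `0`.
    have h1 : w m • (D m : H →L[ℂ] H) ≤ S m := by
      rw [hSc]
      exact Finset.single_le_sum (f := fun k => w k • (D k : H →L[ℂ] H)) (fun k _ => hwD k)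
        (Finset.self_mem_range_succ m)
    have h2 := (hle (hwD m) h1).trans (hK m)
    rw [mul_smul_comm, smul_mul_assoc, norm_smul, Real.norm_of_nonneg (hw0 m)] at h2
    have hwm : 0 < w m := zero_lt_one.trans_le (hw1 m)
    rw [inv_mul_eq_div, le_div_iff₀' hwm]
    exact h2

/-- Passing from a sequence in `W(A)⁺` to a dominating one in `A⁺` shrinks the bundle. -/
theorem bundle_subset_of_le {D D' : ℕ → H →L[ℂ] H} {S S' : Set (H →L[ℂ] H)} (hS : S' ⊆ S)
    (hD0 : ∀ m, 0 ≤ D m) (hDD' : ∀ m, D m ≤ (2 : ℝ) • D' m) : bundle S' D' ⊆ bundle S D := by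
  rintro p ⟨hpS, hp, hp0, ⟨K, hK⟩, hlim⟩
  have hps := hp.isSelfAdjoint
  have hle : ∀ {s t : H →L[ℂ] H}, 0 ≤ s → s ≤ (2 : ℝ) • t →
      ‖p * s * p‖ ≤ 2 * ‖p * t * p‖ := by
    intro s t hs hst
    have h1 := star_left_conjugate_le_conjugate hst p
    rw [hps.star_eq] at h1
    have := CStarAlgebra.norm_le_norm_of_nonneg_of_le (IsSelfAdjoint.conjugate_nonneg hs hps) h1
    rwa [mul_smul_comm, smul_mul_assoc, norm_smul, Real.norm_of_nonneg zero_le_two] at this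
  refine ⟨hS hpS, hp, hp0, ⟨2 * K, ?_⟩, ?_⟩
  · rintro _ ⟨m, rfl⟩
    refine (hle (Finset.sum_nonneg fun k _ => hD0 k) ?_).trans
      (mul_le_mul_of_nonneg_left (hK ⟨m, rfl⟩) zero_le_two)
    rw [Finset.smul_sum]
    exact Finset.sum_le_sum fun k _ => hDD' k
  · exact squeeze_zero (fun _ => norm_nonneg _) (fun m => hle (hD0 m) (hDD' m))
      (by simpa using hlim.const_mul 2)

theorem mul_mul_mem_of_tendsto (hA : IsJWAlgebra A) (hrev : IsReversible A)
    {p : H →L[ℂ] H} (hp : p ∈ A) {x : ℕ → H →L[ℂ] H} (hx : ∀ n, x n ∈ A) {y : H →L[ℂ] H}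
    (h : Tendsto (fun n => ‖(x n - y) * p‖) atTop (𝓝 0)) : p * y * p ∈ A := by
  refine hA.closed.isClosed.mem_of_tendsto (f := fun n => p * x n * p) (b := atTop) ?_
    (Eventually.of_forall fun n => hrev.mul_mul_mem (hx n) hp)
  rw [tendsto_iff_norm_sub_tendsto_zero]
  refine squeeze_zero (g := fun n => ‖p‖ * ‖(x n - y) * p‖) (fun _ => norm_nonneg _) (fun n => ?_)
    (by simpa using h.const_mul ‖p‖)
  have : p * x n * p - p * y * p = p * ((x n - y) * p) := by noncomm_ring
  rw [this]
  exact norm_mul_le _ _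

end Bundle

end JWBundle

end

/-! ### The theorem -/

theorem theorem3p9 {H : Type*} [NormedAddCommGroup H] [InnerProductSpace ℂ H] [CompleteSpace H]
    (A : Submodule ℝ (H →L[ℂ] H)) (hA : JWBundle.IsJWAlgebra A) (hrev : JWBundle.IsReversible A)
    (ρ : A →ₗ[ℝ] ℝ) (hρ : JWBundle.IsFaithfulNormalState A ρ)
    (x : ℕ → H →L[ℂ] H) (hx : ∀ n, x n ∈ A) (y : H →L[ℂ] H)
    (hy : JWBundle.BundleTendstoW (JWBundle.envelope A) (JWBundle.stateExtension A ρ) x y) :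
    JWBundle.BundleTendstoJW A ρ x y := by
  obtain ⟨e, hunit, -⟩ := hρ.unit
  obtain ⟨-, hyW, D, hD0, hDs, hD⟩ := hy
  choose a b hab hle using fun m =>
    JWBundle.exists_isDecomposition hA hrev e.2 hunit (D m).2 (hD0 m)
  have ha0 : ∀ m, 0 ≤ (a m : H →L[ℂ] H) := fun m => by
    have := smul_nonneg (by norm_num : (0 : ℝ) ≤ 2⁻¹)
      ((hD0 m).trans (hle m))
    rwa [smul_smul, inv_mul_cancel₀ two_ne_zero, one_smul] at this
  have has : Summable fun m => ρ (a m) := by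
    have : (fun m => JWBundle.stateExtension A ρ (D m)) = fun m => ((ρ (a m) : ℝ) : ℂ) :=
      funext fun m => JWBundle.stateExtension_eq ρ (hD0 m) (hab m)
    rw [this] at hDs
    exact Complex.summable_ofReal.1 hDs
  have hsub := JWBundle.bundle_subset_of_le
    (S := (JWBundle.envelope A : Set (H →L[ℂ] H))) (S' := (A : Set (H →L[ℂ] H)))
    (fun _ h => JWBundle.subset_envelope A h) hD0 hle
  have hyA : y ∈ A := by
    obtain ⟨p, hp, hpe⟩ := JWBundle.exists_bundle_tendsto hA hrev hρ hunit ha0 has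
    have hpy : ∀ j, p j * y * p j ∈ A := fun j => by
      rcases hp j with h | h
      · simp [h]
      · exact JWBundle.mul_mul_mem_of_tendsto hA hrev h.1 hx (hD _ (hsub h))
    have hpn : ∀ j, ‖p j‖ ≤ 1 := fun j => by
      rcases hp j with h | h
      · simp [h]
      · exact IsStarProjection.norm_le _ h.2.1
    have hye : y * e = y := JWBundle.mul_unit_of_mem_envelope hA e.2 hunit hyW
    have hey : e * y = y := by
      have := congrArg star (JWBundle.mul_unit_of_mem_envelope hA e.2 hunit (star_mem hyW))
      rwa [star_mul, star_star, (hA.selfAdjoint _ e.2).star_eq] at this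
    refine hA.closed.mem_of_tendsto (l := Filter.atTop) hpy fun ξ => ?_
    -- Split `p j y p j ξ = p j (y p j ξ - y ξ) + p j y ξ`: contractivity of `p j` disposes of the
    -- first term, and the second tends to `e y ξ = y ξ`.
    have h1 : Filter.Tendsto (fun j => p j (y (p j ξ) - y ξ)) Filter.atTop (nhds 0) := by
      have h2 : Filter.Tendsto (fun j => ‖y (p j ξ) - y ξ‖) Filter.atTop (nhds 0) := by
        rw [← tendsto_iff_norm_sub_tendsto_zero]
        have := (y.continuous.tendsto _).comp (hpe ξ)
        rwa [show y ((e : H →L[ℂ] H) ξ) = y ξ from congrArg (fun r => r ξ) hye] at this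
      exact squeeze_zero_norm
        (fun j => ((p j).le_of_opNorm_le (hpn j) _).trans_eq (one_mul _)) h2
    have h3 := h1.add (hpe (y ξ))
    rw [show (e : H →L[ℂ] H) (y ξ) = y ξ from congrArg (fun r => r ξ) hey, zero_add] at h3
    exact h3.congr fun j => by simp
  refine ⟨hx, hyA, a, ha0, has, fun p hp => ?_⟩
  have hps := hp.2.1.isSelfAdjoint.star_eq
  have h1 : ∀ n, ‖p * (x n - y) ^ 2 * p‖ = ‖(x n - y) * p‖ * ‖(x n - y) * p‖ := fun n => by
    rw [← CStarRing.norm_star_mul_self, star_mul, hps,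
      ((hA.selfAdjoint _ (hx n)).sub (hA.selfAdjoint _ hyA)).star_eq]
    congr 1
  simp only [h1]
  simpa using (hD p (hsub hp)).mul (hD p (hsub hp))
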